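/- **Discontinuity of the asynchronous capacity at rate $0$.** Let $\mathcal X,\mathcal Y$ be finite alphabets, $Q(\cdot\mid x)$, $x\in\mathcal X$, a discrete memoryless channel from $\mathcal X$ to $\mathcal Y$, $\star\in\mathcal X$ the "no-input" symbol and $Q_\star=Q(\cdot\mid\star)$ the noise distribution. *Codes.* A code of length $n$ at asynchronism level $A\in\{1,2,\dots\}$ consists of $M\ge 2$ distinct codewords $c(m)=c_1(m)\cdots c_n(m)\in\mathcal X^n$, $m\in\{1,\dots,M\}$, and a sequential decoder $(\tau,\phi)$. When message $m$ starts being sent at time $t\in\{1,\dots,A\}$, the outputs $Y_1,\dots,Y_{A+n-1}$ are independent; $Y_i$ has law $Q(\cdot\mid c_{i-t+1}(m))$ for $t\le i\le t+n-1$ and law $Q_\star$ otherwise. Write $\mathbb P_{m,t},\mathbb E_{m,t}$ for the corresponding probability and expectation. Here $\tau\le A+n-1$ is a (possibly randomized) stopping time with respect to $Y_1,Y_2,\dots$, i.e. the conditional probability of $\tau=s$ given all outputs depends only on $Y_1,\dots,Y_s$, and $\phi\in\{1,\dots,M\}$ is a function of $\tau$ and $Y_1,\dots,Y_\tau$. The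 maximum error probability, delay and rate of the code are $$\mathbb P(\mathcal E)=\max_m\frac1A\sum_{t=1}^A\mathbb P_{m,t}(\phi\ne m),\qquad \Delta=\max_m\frac1A\sum_{t=1}^A\mathbb E_{m,t}\big[(\tau-t)^+\big],\qquad \frac{\ln M}{\Delta}$$ (the rate is $\infty$ if $\Delta=0$). *Capacity.* A pair $(R,\alpha)$ with $R,\alpha\ge 0$ is achievable if for every $\varepsilon>0$ and every $n$ large enough there is a code of length $n$ at asynchronism level $A=\lceil e^{(\alpha-\varepsilon)n}\rceil$ with rate at least $R-\varepsilon$ and maximum error probability at most $\varepsilon$. The asynchronous capacity $\alpha(R)\in[0,\infty]$ is the supremum of the $\alpha\ge 0$ for which $(R,\alpha)$ is achievable (and $0$ if there are none). *Claim.* Let $D(\cdot\|\cdot)\in[0,\infty]$ be the information divergence and $\alpha_\circ=\max_{x}D(Q(\cdot\mid x)\|Q_\star)$ the synchronization threshold. If $$\alpha_\circ>\max_{x\in\mathcal X}D(Q_\star\|Q(\cdot\mid x)),$$ then the function $\alpha:[0,\infty)\to[0,\infty]$ is discontinuous at $R=0$. More precisely, $\alpha(R)\le\max_{x}D(Q_\star\|Q(\cdot\mid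 x))$ for every $R>0$, whereas $\alpha(0)=\alpha_\circ>\max_{x}D(Q_\star\|Q(\cdot\mid x))$. -/

import Mathlib

open scoped ENNReal NNReal Topology

noncomputable section

namespace AsyncChannel

variable {X Y : Type*}

/-- Information divergence (natural logarithm, `∞` if `P` is not absolutely continuous w.r.t. `P'`)
between two distributions on a finite alphabet carrying the discrete σ-algebra. -/
def divergence (P P' : PMF Y) : ℝ≥0∞ :=
  letI : MeasurableSpace Y := ⊤
  InformationTheory.klDiv P.toMeasure P'.toMeasure

/-- The synchronization threshold `max_x D(Q(·|x) ‖ Q_⋆)`. -/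
def syncThreshold (Q : X → PMF Y) (star : X) : ℝ≥0∞ :=
  ⨆ x, divergence (Q x) (Q star)

/-- The quantity `max_x D(Q_⋆ ‖ Q(·|x))`. -/
def maxReverseDivergence (Q : X → PMF Y) (star : X) : ℝ≥0∞ :=
  ⨆ x, divergence (Q star) (Q x)

/-- A code (codebook and sequential decoder) of block length `n` at asynchronism level `A`.
Time slots `1, …, A + n - 1` are represented by `Fin (A + n - 1)`, starting from `0`.

The decoder is a sequential test `(τ, φ)`. The stopping time may be randomized: `stopLaw y` is the
conditional law of `τ` given that the whole output sequence is `y`, and the probability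
of `τ = s` depends on the outputs up to time `s` only. A deterministic stopping time is the case of
point masses. The decision `decision s y` is the message declared when `τ = s`; it too depends on
the outputs up to time `s` only. -/
structure Code (X Y : Type*) (n A : ℕ) where
  /-- number of messages -/
  M : ℕ
  two_le_M : 2 ≤ M
  /-- `codeword m k` is the `(k+1)`-st symbol of the codeword of message `m` -/
  codeword : Fin M → Fin n → X
  codeword_injective : Function.Injective codeword
  stopLaw : (Fin (A + n - 1) → Y) → PMF (Fin (A + n - 1))
  stopLaw_adapted : ∀ (s : Fin (A + n - 1)) (y y' : Fin (A + n - 1) → Y),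
    (∀ i, i ≤ s → y i = y' i) → stopLaw y s = stopLaw y' s
  decision : Fin (A + n - 1) → (Fin (A + n - 1) → Y) → Fin M
  decision_adapted : ∀ (s : Fin (A + n - 1)) (y y' : Fin (A + n - 1) → Y),
    (∀ i, i ≤ s → y i = y' i) → decision s y = decision s y'

namespace Code

variable {n A : ℕ}

/-- The channel input in slot `i` when message `m` starts being sent in slot `t`: the transmitter
is silent (input `star`) outside the slots `t, …, t + n - 1`. -/
def input (c : Code X Y n A) (star : X) (m : Fin c.M) (t : Fin A) (i : Fin (A + n - 1)) : X :=
  if h : (t : ℕ) ≤ i ∧ (i : ℕ) < t + n then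
    c.codeword m ⟨(i : ℕ) - t, by omega⟩
  else star

/-- `ℙ_{m,t}(y)`: the probability of the output sequence `y` when message `m` starts being sent at
time `t` over the memoryless channel `Q`. -/
def outputProb (c : Code X Y n A) (Q : X → PMF Y) (star : X) (m : Fin c.M) (t : Fin A)
    (y : Fin (A + n - 1) → Y) : ℝ≥0∞ :=
  ∏ i, Q (c.input star m t i) (y i)

variable [Fintype Y]

/-- `𝔼_{m,t} f(τ, Y)` for a nonnegative function `f` of the stopping time and the outputs. -/
def expect (c : Code X Y n A) (Q : X → PMF Y) (star : X) (m : Fin c.M) (t : Fin A)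
    (f : Fin (A + n - 1) → (Fin (A + n - 1) → Y) → ℝ≥0∞) : ℝ≥0∞ :=
  ∑ y, c.outputProb Q star m t y * ∑ s, c.stopLaw y s * f s y

/-- Maximum (over messages) time-averaged error probability
`max_m (1/A) ∑_t ℙ_{m,t}(φ ≠ m)`. -/
def errorProb (c : Code X Y n A) (Q : X → PMF Y) (star : X) : ℝ≥0∞ :=
  ⨆ m, (∑ t, c.expect Q star m t fun s y => if c.decision s y = m then 0 else 1) / A

/-- The delay `max_m (1/A) ∑_t 𝔼_{m,t} (τ - t)⁺`; subtraction in `ℕ` is truncated at `0`. -/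
def delay (c : Code X Y n A) (Q : X → PMF Y) (star : X) : ℝ≥0∞ :=
  ⨆ m, (∑ t, c.expect Q star m t fun s _ => (((s : ℕ) - (t : ℕ) : ℕ) : ℝ≥0∞)) / A

/-- The rate `ln M / delay`, infinite if the delay is zero. -/
def rate (c : Code X Y n A) (Q : X → PMF Y) (star : X) : ℝ≥0∞ :=
  ENNReal.ofReal (Real.log c.M) / c.delay Q star

end Code

variable [Fintype Y]

/-- The rate-exponent pair `(R, α)` is achievable: for every `ε > 0` and every large `n` there is a
code of length `n` that operates at asynchronism level `e^{(α - ε) n}` (rounded up to an integer),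
has rate at least `R - ε` and maximum error probability at most `ε`. -/
def Achievable (Q : X → PMF Y) (star : X) (R α : ℝ≥0) : Prop :=
  ∀ ε : ℝ, 0 < ε → ∀ᶠ n : ℕ in Filter.atTop,
    ∃ c : Code X Y n ⌈Real.exp (((α : ℝ) - ε) * n)⌉₊,
      ENNReal.ofReal ((R : ℝ) - ε) ≤ c.rate Q star ∧
      c.errorProb Q star ≤ ENNReal.ofReal ε

/-- The asynchronous capacity `α(R)`: the supremum of the exponents achievable at rate `R`
(zero if there are none). -/
def asyncCapacity (Q : X → PMF Y) (star : X) (R : ℝ≥0) : ℝ≥0∞ :=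
  ⨆ (α : ℝ≥0) (_ : Achievable Q star R α), (α : ℝ≥0∞)

end AsyncChannel

end

open Filter MeasureTheory
open scoped ENNReal NNReal Topology

noncomputable section

namespace AsyncChannel

section

variable {X Y : Type*}

/-! ### Divergence on a finite alphabet. -/

section Divergence

variable [Fintype Y]

/-! Everything follows from three bounds on the exponents.

Positive rate, upper bound. A decision made before the codeword starts is based on noise alone,
hence wrong for one of any two messages. So under pure noise a good decoder survives past time A/2
with probability at least 3/4. By change of measure, a codeword started before A/4 is mistaken for
noise with probability about e^{-nβ}, where β is the largest reverse divergence, and the delay is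
then at least A/4. The mean delay is thus of order A e^{-nβ} (`delay_lower_bound`). Positive rate
allows only a delay linear in n, since ln M ≤ n ln |X|. Hence ln A cannot exceed nβ by a linear
term.

Rate zero, lower bound. The delay is unconstrained, so the decoder may wait until the end. Two
messages suffice, a repeated best symbol and silence, separated by a likelihood-ratio test over all
start times. The union bound over A start times is affordable when A is exponentially below e^{nD},
with D the divergence of that symbol from the noise (`burstCode`, `exists_burst_miss_bound`).

Rate zero, upper bound. If A is exponentially above e^{nα_∘}, the output law averaged over the start
time is nearly the noise law, by a second-moment computation with truncated likelihood ratios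
(`inputExpect_star_le`). Every message then looks like noise, and two messages cannot both be
decoded. -/

lemma toReal_pmf_sum (P : PMF Y) : ∑ b, (P b).toReal = 1 := by
  rw [← ENNReal.toReal_sum (fun b _ => P.apply_ne_top b), ← tsum_fintype (L := .unconditional Y),
    P.tsum_coe, ENNReal.toReal_one]

/-- On a finite alphabet the divergence is infinite only without absolute continuity; otherwise it
is given by the usual finite sum. -/
lemma divergence_eq_sum (P P' : PMF Y) (hac : ∀ b, P' b = 0 → P b = 0) :
    divergence P P' ≠ ∞ ∧ (divergence P P').toReal
      = ∑ b, (P b).toReal * Real.log ((P b).toReal / (P' b).toReal) := by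
  let _ : MeasurableSpace Y := ⊤
  have hden : P.toMeasure = P'.toMeasure.withDensity (fun b => P b / P' b) := by
    refine Measure.ext_of_singleton fun b => ?_
    rw [withDensity_apply _ (measurableSet_singleton b), lintegral_singleton,
      P.toMeasure_apply_singleton b (measurableSet_singleton b),
      P'.toMeasure_apply_singleton b (measurableSet_singleton b)]
    by_cases hb : P' b = 0
    · simp [hb, hac b hb]
    · rw [ENNReal.div_mul_cancel hb (P'.apply_ne_top b)]
  have hll : P.toMeasure ≪ P'.toMeasure := by
    rw [hden]; exact withDensity_absolutelyContinuous _ _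
  have hrn : P.toMeasure.rnDeriv P'.toMeasure =ᵐ[P.toMeasure] fun b => P b / P' b := by
    refine hll.ae_le ?_
    have := Measure.rnDeriv_withDensity P'.toMeasure (f := fun b => P b / P' b) measurable_from_top
    rwa [← hden] at this
  have hllr : llr P.toMeasure P'.toMeasure =ᵐ[P.toMeasure]
      fun b => Real.log ((P b).toReal / (P' b).toReal) := by
    filter_upwards [hrn] with b hb
    rw [llr, hb, ENNReal.toReal_div]
  have hint : Integrable (llr P.toMeasure P'.toMeasure) P.toMeasure := Integrable.of_finite
  refine ⟨InformationTheory.klDiv_ne_top hll hint, ?_⟩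
  -- Both measures have mass one, so the mass-correction term in `klDiv` vanishes.
  have := InformationTheory.toReal_klDiv_of_measure_eq hll (by simp)
  rw [divergence, this, integral_congr_ae hllr, PMF.integral_eq_sum]
  simp [smul_eq_mul]

lemma absolutelyContinuous_of_divergence_ne_top (P P' : PMF Y) (h : divergence P P' ≠ ∞) (b : Y)
    (hb : P' b = 0) : P b = 0 := by
  let _ : MeasurableSpace Y := ⊤
  have hll := (InformationTheory.klDiv_ne_top_iff.1 h).1
  have := hll (s := {b}) (by
    rw [P'.toMeasure_apply_singleton b (measurableSet_singleton b), hb])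
  rwa [P.toMeasure_apply_singleton b (measurableSet_singleton b)] at this

end Divergence

/-! ### Exponential moments and product laws. -/

section Chernoff

variable [Fintype Y] {ι : Type*} [Fintype ι]

/-- To first order in s, the logarithm of the exponential moment is s times the mean, so any μ above
the mean dominates for small s > 0. The bound e^u ≤ 1 + u + u² for |u| ≤ 1 makes this quantitative.
It supplies the exponent for every Chernoff bound below. -/
lemma eventually_sum_mul_exp_le (w f : Y → ℝ) (hw : ∀ b, 0 ≤ w b) (hw1 : ∑ b, w b = 1)
    {μ : ℝ} (hμ : ∑ b, w b * f b < μ) :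
    ∀ᶠ s : ℝ in 𝓝[>] 0, ∑ b, w b * Real.exp (s * f b) ≤ Real.exp (s * μ) := by
  set K : ℝ := 1 + ∑ b, |f b|
  have hK : 1 ≤ K := le_add_of_nonneg_right (Finset.sum_nonneg fun _ _ => abs_nonneg _)
  have hf : ∀ b, |f b| ≤ K := fun b =>
    (Finset.single_le_sum (fun i _ => abs_nonneg (f i)) (Finset.mem_univ b)).trans (by simp [K])
  have hpos : 0 < min (1 / K) ((μ - ∑ b, w b * f b) / K ^ 2) :=
    lt_min (by positivity) (div_pos (by linarith) (by positivity))
  filter_upwards [Ioo_mem_nhdsGT hpos] with s ⟨hs0, hs⟩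
  have hs1 : s * K ≤ 1 := by
    have := hs.le.trans (min_le_left _ _)
    rwa [le_div_iff₀ (by positivity)] at this
  have hs2 : s * K ^ 2 ≤ μ - ∑ b, w b * f b := by
    have := hs.le.trans (min_le_right _ _)
    rwa [le_div_iff₀ (by positivity)] at this
  have hb : ∀ b, Real.exp (s * f b) ≤ 1 + s * f b + s * (s * K ^ 2) := fun b => by
    have h1 : |s * f b| ≤ 1 := by
      rw [abs_mul, abs_of_pos hs0]
      exact (mul_le_mul_of_nonneg_left (hf b) hs0.le).trans hs1
    have h2 := (abs_le.1 (Real.abs_exp_sub_one_sub_id_le h1)).2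
    have h3 : f b ^ 2 ≤ K ^ 2 := sq_le_sq.2 ((hf b).trans (le_abs_self K))
    nlinarith [mul_le_mul_of_nonneg_left h3 (sq_nonneg s)]
  calc ∑ b, w b * Real.exp (s * f b)
      ≤ ∑ b, w b * (1 + s * f b + s * (s * K ^ 2)) :=
        Finset.sum_le_sum fun b _ => mul_le_mul_of_nonneg_left (hb b) (hw b)
    _ = ∑ b, w b + s * ∑ b, w b * f b + (∑ b, w b) * (s * (s * K ^ 2)) := by
        rw [Finset.mul_sum, Finset.sum_mul, ← Finset.sum_add_distrib, ← Finset.sum_add_distrib]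
        exact Finset.sum_congr rfl fun b _ => by ring
    _ ≤ s * μ + 1 := by rw [hw1]; nlinarith
    _ ≤ Real.exp (s * μ) := Real.add_one_le_exp _

lemma sum_prod_eq [DecidableEq ι] (w : ι → Y → ℝ) :
    ∑ y : ι → Y, ∏ i, w i (y i) = ∏ i, ∑ b, w i b :=
  (Fintype.prod_sum w).symm

lemma sum_prod_eq_one [DecidableEq ι] (w : ι → Y → ℝ) (hw : ∀ i, ∑ b, w i b = 1) :
    ∑ y : ι → Y, ∏ i, w i (y i) = 1 := by
  rw [sum_prod_eq]; simp [hw]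

/-- Markov's inequality for the exponential of the sum, whose expectation factors over the
coordinates. -/
lemma chernoff_bound [DecidableEq ι] (w f : ι → Y → ℝ) (hw : ∀ i b, 0 ≤ w i b) {s : ℝ}
    (hs : 0 ≤ s) (a : ℝ) :
    ∑ y : ι → Y, (∏ i, w i (y i)) * (if a < ∑ i, f i (y i) then 1 else 0)
      ≤ Real.exp (-(s * a)) * ∏ i, ∑ b, w i b * Real.exp (s * f i b) := by
  rw [← sum_prod_eq (fun i b => w i b * Real.exp (s * f i b)), Finset.mul_sum]
  refine Finset.sum_le_sum fun y _ => ?_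
  rw [Finset.prod_mul_distrib, ← Real.exp_sum, ← Finset.mul_sum, mul_left_comm, ← Real.exp_add]
  refine mul_le_mul_of_nonneg_left ?_ (Finset.prod_nonneg fun i _ => hw i _)
  split_ifs with h
  · exact Real.one_le_exp (by nlinarith)
  · positivity

/-- Functionals of the coordinates in `S` do not see the law of the other coordinates. -/
lemma sum_prod_mul_congr [DecidableEq ι] (w w' : ι → Y → ℝ) (S : ι → Prop)
    (hw : ∀ i, ∑ b, w i b = 1) (hw' : ∀ i, ∑ b, w' i b = 1) (hS : ∀ i, S i → w i = w' i)
    (g : (ι → Y) → ℝ) (hg : ∀ y y', (∀ i, S i → y i = y' i) → g y = g y') :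
    ∑ y, (∏ i, w i (y i)) * g y = ∑ y, (∏ i, w' i (y i)) * g y := by
  classical
  -- With Y empty the weights cannot sum to one at any index, so there are no indices. Otherwise
  -- `b₀` is an arbitrary filler for the coordinates that `g` ignores.
  rcases isEmpty_or_nonempty Y with hY | ⟨⟨b₀⟩⟩
  · have : IsEmpty ι := ⟨fun i => by simpa using hw i⟩
    simp
  let e := Equiv.piEquivPiSubtypeProd S (fun _ => Y)
  have key : ∀ v : ι → Y → ℝ, (∀ i, ∑ b, v i b = 1) → ∑ y, (∏ i, v i (y i)) * g y
      = ∑ z : {i // S i} → Y, (∏ i, v i.1 (z i)) * g (e.symm (z, fun _ => b₀)) := by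
    intro v hv
    rw [← e.symm.sum_comp, Fintype.sum_prod_type]
    refine Finset.sum_congr rfl fun z _ => ?_
    have h1 : ∀ u : {i // ¬ S i} → Y, (∏ i, v i (e.symm (z, u) i)) * g (e.symm (z, u))
        = (∏ i, v i.1 (z i)) * g (e.symm (z, fun _ => b₀)) * ∏ i, v i.1 (u i) := by
      intro u
      have hgu : g (e.symm (z, u)) = g (e.symm (z, fun _ => b₀)) :=
        hg _ _ fun i hi => by simp [e, Equiv.piEquivPiSubtypeProd, hi]
      rw [hgu, ← Fintype.prod_subtype_mul_prod_subtype S]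
      have h2 : ∀ i : {i // S i}, e.symm (z, u) i = z i := fun i => by
        simp [e, Equiv.piEquivPiSubtypeProd, i.2]
      have h3 : ∀ i : {i // ¬ S i}, e.symm (z, u) i = u i := fun i => by
        simp [e, Equiv.piEquivPiSubtypeProd, i.2]
      simp only [h2, h3]
      ring
    simp_rw [h1]
    rw [← Finset.mul_sum, sum_prod_eq_one (fun i : {i // ¬ S i} => v i.1) (fun i => hv i), mul_one]
  rw [key w hw, key w' hw']
  refine Finset.sum_congr rfl fun z _ => ?_
  congr 1
  exact Finset.prod_congr rfl fun i _ => by rw [hS i.1 i.2]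

end Chernoff

end

/-! ### Decoder expectations and the delay lower bound. -/

section

variable {X Y : Type*} {n A : ℕ}

namespace Code

lemma sum_stopLaw (c : Code X Y n A) (y : Fin (A + n - 1) → Y) :
    ∑ s, (c.stopLaw y s).toReal = 1 := toReal_pmf_sum _

lemma sum_stopLaw_mul_nonneg (c : Code X Y n A)
    {f : Fin (A + n - 1) → (Fin (A + n - 1) → Y) → ℝ} (hf : ∀ s y, 0 ≤ f s y)
    (y : Fin (A + n - 1) → Y) : 0 ≤ ∑ s, (c.stopLaw y s).toReal * f s y :=
  Finset.sum_nonneg fun s _ => mul_nonneg ENNReal.toReal_nonneg (hf s y)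

lemma sum_stopLaw_mul_le_one (c : Code X Y n A)
    {f : Fin (A + n - 1) → (Fin (A + n - 1) → Y) → ℝ} (hf : ∀ s y, f s y ≤ 1)
    (y : Fin (A + n - 1) → Y) : ∑ s, (c.stopLaw y s).toReal * f s y ≤ 1 := by
  rw [← c.sum_stopLaw y]
  exact Finset.sum_le_sum fun s _ => mul_le_of_le_one_right ENNReal.toReal_nonneg (hf s y)

/-- Only the n slots of the codeword contribute, since silent slots give a factor 1. This keeps all
likelihood estimates independent of A. -/
lemma prod_input (c : Code X Y n A) (star : X) {R : Type*} [CommMonoid R] (m : Fin c.M) (t : Fin A) (F : X → R)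
    (hF : F star = 1) :
    ∏ i, F (c.input star m t i) = ∏ k, F (c.codeword m k) := by
  symm
  refine Finset.prod_of_injOn (fun k : Fin n => (⟨t + k, by omega⟩ : Fin (A + n - 1))) ?_ ?_ ?_ ?_
  · intro k _ k' _ h
    simpa [Fin.ext_iff] using h
  · intro k _; simp
  · intro i _ hi
    rw [input, dif_neg, hF]
    rintro ⟨h1, h2⟩
    refine hi ⟨⟨i - t, by omega⟩, by simp, ?_⟩
    ext; simp; omega
  · intro k _
    rw [input, dif_pos ⟨by simp, by simp⟩]
    congr 2
    ext; simp

variable [Fintype Y]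

/-- The expectation of `f (τ, Y)` when the channel input is the deterministic sequence `u`. -/
def inputExpect (c : Code X Y n A) (Q : X → PMF Y) (u : Fin (A + n - 1) → X)
    (f : Fin (A + n - 1) → (Fin (A + n - 1) → Y) → ℝ) : ℝ :=
  ∑ y, (∏ i, (Q (u i) (y i)).toReal) * ∑ s, (c.stopLaw y s).toReal * f s y

variable (c : Code X Y n A) (Q : X → PMF Y) (star : X)

lemma inputExpect_nonneg (u : Fin (A + n - 1) → X)
    {f : Fin (A + n - 1) → (Fin (A + n - 1) → Y) → ℝ} (hf : ∀ s y, 0 ≤ f s y) :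
    0 ≤ c.inputExpect Q u f :=
  Finset.sum_nonneg fun y _ => mul_nonneg
    (Finset.prod_nonneg fun _ _ => ENNReal.toReal_nonneg) (c.sum_stopLaw_mul_nonneg hf y)

lemma inputExpect_mono (u : Fin (A + n - 1) → X)
    {f g : Fin (A + n - 1) → (Fin (A + n - 1) → Y) → ℝ} (hfg : ∀ s y, f s y ≤ g s y) :
    c.inputExpect Q u f ≤ c.inputExpect Q u g :=
  Finset.sum_le_sum fun y _ => mul_le_mul_of_nonneg_left
    (Finset.sum_le_sum fun s _ => mul_le_mul_of_nonneg_left (hfg s y) ENNReal.toReal_nonneg)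
    (Finset.prod_nonneg fun _ _ => ENNReal.toReal_nonneg)

lemma inputExpect_add (u : Fin (A + n - 1) → X)
    (f g : Fin (A + n - 1) → (Fin (A + n - 1) → Y) → ℝ) :
    c.inputExpect Q u (fun s y => f s y + g s y)
      = c.inputExpect Q u f + c.inputExpect Q u g := by
  simp only [inputExpect, mul_add, Finset.sum_add_distrib]

lemma inputExpect_const_mul (u : Fin (A + n - 1) → X) (r : ℝ)
    (f : Fin (A + n - 1) → (Fin (A + n - 1) → Y) → ℝ) :
    c.inputExpect Q u (fun s y => r * f s y) = r * c.inputExpect Q u f := by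
  simp only [inputExpect, Finset.mul_sum]
  exact Finset.sum_congr rfl fun y _ => Finset.sum_congr rfl fun s _ => by ring

lemma inputExpect_one (u : Fin (A + n - 1) → X) :
    c.inputExpect Q u (fun _ _ => 1) = 1 := by
  simp only [inputExpect, mul_one, sum_stopLaw]
  exact sum_prod_eq_one (fun i b => (Q (u i) b).toReal) fun i => toReal_pmf_sum _

lemma expect_ofReal (m : Fin c.M) (t : Fin A)
    {f : Fin (A + n - 1) → (Fin (A + n - 1) → Y) → ℝ} (hf : ∀ s y, 0 ≤ f s y) :
    c.expect Q star m t (fun s y => ENNReal.ofReal (f s y))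
      = ENNReal.ofReal (c.inputExpect Q (c.input star m t) f) := by
  rw [expect, inputExpect, ENNReal.ofReal_sum_of_nonneg fun y _ => mul_nonneg
    (Finset.prod_nonneg fun _ _ => ENNReal.toReal_nonneg) (c.sum_stopLaw_mul_nonneg hf y)]
  refine Finset.sum_congr rfl fun y _ => ?_
  rw [ENNReal.ofReal_mul (Finset.prod_nonneg fun _ _ => ENNReal.toReal_nonneg),
    ENNReal.ofReal_prod_of_nonneg fun _ _ => ENNReal.toReal_nonneg,
    ENNReal.ofReal_sum_of_nonneg fun s _ => mul_nonneg ENNReal.toReal_nonneg (hf s y), outputProb]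
  congr 1
  · exact Finset.prod_congr rfl fun i _ => (ENNReal.ofReal_toReal (PMF.apply_ne_top _ _)).symm
  · refine Finset.sum_congr rfl fun s _ => ?_
    rw [ENNReal.ofReal_mul ENNReal.toReal_nonneg, ENNReal.ofReal_toReal (PMF.apply_ne_top _ _)]

lemma sum_expect_div_le_iff (hA : 0 < A) (m : Fin c.M) {r : ℝ} (hr : 0 ≤ r)
    {f : Fin A → Fin (A + n - 1) → (Fin (A + n - 1) → Y) → ℝ} (hf : ∀ t s y, 0 ≤ f t s y) :
    (∑ t, c.expect Q star m t (fun s y => ENNReal.ofReal (f t s y))) / A ≤ ENNReal.ofReal r ↔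
      ∑ t, c.inputExpect Q (c.input star m t) (f t) ≤ r * A := by
  have hA' : (0 : ℝ) ≤ A := Nat.cast_nonneg A
  rw [ENNReal.div_le_iff (by exact_mod_cast hA.ne') (ENNReal.natCast_ne_top A),
    ← ENNReal.ofReal_natCast, ← ENNReal.ofReal_mul hr, ← ENNReal.ofReal_le_ofReal_iff (by positivity),
    ENNReal.ofReal_sum_of_nonneg fun t _ => c.inputExpect_nonneg Q _ (hf t)]
  simp only [c.expect_ofReal Q star m _ (hf _)]

lemma errorProb_le_iff (hA : 0 < A) {ε : ℝ} (hε : 0 ≤ ε) :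
    c.errorProb Q star ≤ ENNReal.ofReal ε ↔ ∀ m, ∑ t, c.inputExpect Q (c.input star m t)
      (fun s y => if c.decision s y = m then 0 else 1) ≤ ε * A := by
  rw [errorProb, iSup_le_iff]
  refine forall_congr' fun m => ?_
  rw [← c.sum_expect_div_le_iff Q star hA m hε (fun _ _ _ => by split_ifs <;> norm_num)]
  simp only [apply_ite ENNReal.ofReal, ENNReal.ofReal_zero, ENNReal.ofReal_one]

/-- The only use of a positive rate: the delay is capped by ln M / r. -/
lemma sum_delay_le_of_le_rate (hA : 0 < A) {r : ℝ} (hr : 0 < r)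
    (h : ENNReal.ofReal r ≤ c.rate Q star) (m : Fin c.M) :
    ∑ t, c.inputExpect Q (c.input star m t) (fun s _ => (((s : ℕ) - (t : ℕ) : ℕ) : ℝ))
      ≤ Real.log c.M / r * A := by
  have hlog : 0 ≤ Real.log c.M := Real.log_natCast_nonneg _
  rw [← c.sum_expect_div_le_iff Q star hA m (div_nonneg hlog hr.le)
    (fun _ _ _ => Nat.cast_nonneg _)]
  simp only [ENNReal.ofReal_natCast]
  refine (le_iSup (fun m => (∑ t, c.expect Q star m t
    fun s _ => (((s : ℕ) - (t : ℕ) : ℕ) : ℝ≥0∞)) / A) m).trans ?_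
  rw [ENNReal.ofReal_div_of_pos hr, ENNReal.le_div_iff_mul_le (by simp [hr]) (by simp), mul_comm]
  exact ENNReal.mul_le_of_le_div h

/-- Before the codeword starts the decoder only sees noise. -/
lemma inputExpect_input_of_prefix (m : Fin c.M) (t : Fin A)
    {f : Fin (A + n - 1) → (Fin (A + n - 1) → Y) → ℝ}
    (hf0 : ∀ (s : Fin (A + n - 1)) y, (t : ℕ) ≤ s → f s y = 0)
    (hf : ∀ s y y', (∀ i, i ≤ s → y i = y' i) → f s y = f s y') :
    c.inputExpect Q (c.input star m t) f = c.inputExpect Q (fun _ => star) f := by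
  refine sum_prod_mul_congr (fun i b => (Q (c.input star m t i) b).toReal)
    (fun _ b => (Q star b).toReal) (fun i => (i : ℕ) < t) (fun i => toReal_pmf_sum _)
    (fun i => toReal_pmf_sum _) ?_ _ ?_
  · intro i hi
    rw [input, dif_neg (by omega)]
  · intro y y' h
    refine Finset.sum_congr rfl fun s _ => ?_
    by_cases hs : (t : ℕ) ≤ s
    · rw [hf0 s y hs, hf0 s y' hs, mul_zero, mul_zero]
    · have h' : ∀ i, i ≤ s → y i = y' i := fun i hi => h i (by have : (i : ℕ) ≤ s := hi; omega)
      rw [hf s y y' h', c.stopLaw_adapted s y y' h']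

/-- A decoder that distinguishes two messages rarely stops before the codeword starts. -/
lemma inputExpect_early_le {m m' : Fin c.M} (hm : m ≠ m') (t : Fin A) :
    c.inputExpect Q (fun _ => star) (fun s _ => if (s : ℕ) < t then 1 else 0)
      ≤ c.inputExpect Q (c.input star m t) (fun s y => if c.decision s y = m then 0 else 1)
        + c.inputExpect Q (c.input star m' t)
          (fun s y => if c.decision s y = m' then 0 else 1) := by
  -- Stopping before t with a decision other than k has the same probability under noise as when k
  -- is sent at t, where it is an error. An early decision differs from m or from m'.
  have h1 : ∀ k : Fin c.M, c.inputExpect Q (fun _ => star)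
        (fun s y => if (s : ℕ) < t ∧ c.decision s y ≠ k then 1 else 0)
      ≤ c.inputExpect Q (c.input star k t) (fun s y => if c.decision s y = k then 0 else 1) := by
    intro k
    rw [← c.inputExpect_input_of_prefix Q star k t]
    · refine c.inputExpect_mono Q _ fun s y => ?_
      split_ifs <;> simp_all
    · intro s y hs
      rw [if_neg (by omega)]
    · intro s y y' h
      rw [c.decision_adapted s y y' h]
  refine le_trans ?_ (add_le_add (h1 m) (h1 m'))
  rw [← inputExpect_add]
  refine c.inputExpect_mono Q _ fun s y => ?_
  by_cases hs : (s : ℕ) < t <;> by_cases h2 : c.decision s y = m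
  · simp [hs, h2, hm]
  · simp only [hs, h2, true_and, ne_eq, not_false_eq_true, if_true]
    split_ifs <;> norm_num
  · simp [hs]
  · simp [hs]

/-- Change of measure from the noise to the law of the output under an input sequence. -/
lemma exp_neg_mul_inputExpect_le (hac : ∀ x b, Q x b = 0 → Q star b = 0)
    (u : Fin (A + n - 1) → X) (a : ℝ)
    {f : Fin (A + n - 1) → (Fin (A + n - 1) → Y) → ℝ} (hf0 : ∀ s y, 0 ≤ f s y)
    (hf1 : ∀ s y, f s y ≤ 1) :
    Real.exp (-a) * (c.inputExpect Q (fun _ => star) f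
      - ∑ y : Fin (A + n - 1) → Y, (∏ i, (Q star (y i)).toReal) *
        (if a < ∑ i, Real.log ((Q star (y i)).toReal / (Q (u i) (y i)).toReal) then 1 else 0))
      ≤ c.inputExpect Q u f := by
  rw [inputExpect, inputExpect, ← Finset.sum_sub_distrib, Finset.mul_sum]
  refine Finset.sum_le_sum fun y _ => ?_
  have h0 := c.sum_stopLaw_mul_nonneg hf0 y
  have h1 := c.sum_stopLaw_mul_le_one hf1 y
  set g := ∑ s, (c.stopLaw y s).toReal * f s y
  have hw : 0 ≤ ∏ i, (Q star (y i)).toReal := Finset.prod_nonneg fun _ _ => ENNReal.toReal_nonneg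
  have hw' : 0 ≤ ∏ i, (Q (u i) (y i)).toReal :=
    Finset.prod_nonneg fun _ _ => ENNReal.toReal_nonneg
  split_ifs with ha
  -- Here the summand on the left is a weight times g - 1 ≤ 0, so the exceptional event costs
  -- nothing.
  · refine le_trans ?_ (mul_nonneg hw' h0)
    exact mul_nonpos_of_nonneg_of_nonpos (Real.exp_pos _).le (by nlinarith)
  · rw [mul_zero, sub_zero, ← mul_assoc]
    refine mul_le_mul_of_nonneg_right ?_ h0
    by_cases hz : ∏ i, (Q star (y i)).toReal = 0
    · rw [hz, mul_zero]; exact hw'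
    · have hpos : ∀ i, 0 < (Q star (y i)).toReal := fun i =>
        lt_of_le_of_ne ENNReal.toReal_nonneg
          (Ne.symm (Finset.prod_ne_zero_iff.1 hz i (Finset.mem_univ i)))
      have hpos' : ∀ i, 0 < (Q (u i) (y i)).toReal := fun i =>
        ENNReal.toReal_pos (fun h => (hpos i).ne' (by rw [hac _ _ h, ENNReal.toReal_zero]))
          (PMF.apply_ne_top _ _)
      have : ∏ i, (Q star (y i)).toReal
          ≤ Real.exp a * ∏ i, (Q (u i) (y i)).toReal := by
        calc ∏ i, (Q star (y i)).toReal
            = Real.exp (∑ i, Real.log ((Q star (y i)).toReal / (Q (u i) (y i)).toReal))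
              * ∏ i, (Q (u i) (y i)).toReal := by
              rw [Real.exp_sum, ← Finset.prod_mul_distrib]
              refine Finset.prod_congr rfl fun i _ => ?_
              rw [Real.exp_log (div_pos (hpos i) (hpos' i)), div_mul_cancel₀ _ (hpos' i).ne']
          _ ≤ _ := mul_le_mul_of_nonneg_right (Real.exp_le_exp.2 (not_lt.1 ha)) hw'
      calc Real.exp (-a) * ∏ i, (Q star (y i)).toReal
          ≤ Real.exp (-a) * (Real.exp a * ∏ i, (Q (u i) (y i)).toReal) :=
            mul_le_mul_of_nonneg_left this (Real.exp_pos _).le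
        _ = _ := by rw [← mul_assoc, ← Real.exp_add]; simp

/-- Small error probability forces a delay of the order of `A` times the probability that the
codeword is mistaken for noise. -/
lemma delay_lower_bound (hac : ∀ x b, Q x b = 0 → Q star b = 0) (hA : 8 ≤ A) (a : ℝ)
    (herr : ∀ m, ∑ t, c.inputExpect Q (c.input star m t)
      (fun s y => if c.decision s y = m then 0 else 1) ≤ 1 / 16 * A) (m : Fin c.M)
    (hbad : ∀ t, ∑ y : Fin (A + n - 1) → Y, (∏ i, (Q star (y i)).toReal) *
      (if a < ∑ i, Real.log ((Q star (y i)).toReal / (Q (c.input star m t i) (y i)).toReal)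
        then 1 else 0) ≤ 1 / 4) :
    (A : ℝ) ^ 2 / 128 * Real.exp (-a)
      ≤ ∑ t, c.inputExpect Q (c.input star m t) (fun s _ => (((s : ℕ) - (t : ℕ) : ℕ) : ℝ)) := by
  have hM := c.two_le_M
  have hAr : (8 : ℝ) ≤ A := by exact_mod_cast hA
  -- under noise the decoder rarely stops in the first half
  have hearly : c.inputExpect Q (fun _ => star) (fun s _ => if (s : ℕ) < A / 2 then 1 else 0)
      ≤ 1 / 4 := by
    set p := c.inputExpect Q (fun _ => star) (fun s _ => if (s : ℕ) < A / 2 then 1 else 0)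
    have hp : 0 ≤ p := c.inputExpect_nonneg Q _ fun _ _ => by split_ifs <;> norm_num
    -- At least A/2 start times lie beyond A/2, and each pays at least p in the errors of two
    -- messages together. Hence pA/2 ≤ A/8.
    have h1 : ∑ t : Fin A, (if A / 2 ≤ (t : ℕ) then p else 0) ≤ 1 / 16 * A + 1 / 16 * A := by
      refine le_trans ?_ (add_le_add (herr ⟨0, by omega⟩) (herr ⟨1, by omega⟩))
      rw [← Finset.sum_add_distrib]
      refine Finset.sum_le_sum fun t _ => ?_
      refine le_trans ?_ (c.inputExpect_early_le Q star (by simp) t)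
      split_ifs with ht
      · refine c.inputExpect_mono Q _ fun s y => ?_
        split_ifs <;> first | omega | norm_num
      · exact c.inputExpect_nonneg Q _ fun _ _ => by split_ifs <;> norm_num
    rw [Fin.sum_univ_eq_sum_range (fun t => if A / 2 ≤ t then p else 0) A, ← Finset.sum_filter,
      Finset.sum_const, nsmul_eq_mul] at h1
    have h2 : A - A / 2 ≤ ((Finset.range A).filter fun t => A / 2 ≤ t).card := by
      rw [← Nat.card_Ico]
      refine Finset.card_le_card fun t ht => ?_
      simp at ht ⊢; omega
    have h3 : (A : ℝ) / 2 ≤ ((Finset.range A).filter fun t => A / 2 ≤ t).card := by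
      have : A ≤ 2 * ((Finset.range A).filter fun t => A / 2 ≤ t).card := by omega
      have : (A : ℝ) ≤ 2 * ((Finset.range A).filter fun t => A / 2 ≤ t).card := by
        exact_mod_cast this
      linarith
    nlinarith [mul_le_mul_of_nonneg_right h3 hp]
  have hlate : 3 / 4 ≤ c.inputExpect Q (fun _ => star)
      (fun s _ => if (s : ℕ) < A / 2 then 0 else 1) := by
    have h1 := c.inputExpect_add Q (fun _ => star) (fun s _ => if (s : ℕ) < A / 2 then 1 else 0)
      (fun s _ => if (s : ℕ) < A / 2 then 0 else 1)
    have h2 : (fun (s : Fin (A + n - 1)) (_ : Fin (A + n - 1) → Y) =>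
        (if (s : ℕ) < A / 2 then (1 : ℝ) else 0) + (if (s : ℕ) < A / 2 then 0 else 1))
        = fun _ _ => 1 := by
      funext s _; split_ifs <;> norm_num
    rw [h2, inputExpect_one] at h1
    linarith
  -- For starts before A/4 and stops after A/2 the delay is at least q. There are q such starts,
  -- each contributing q e^{-a}/2, and q ≥ A/8 gives the constant 128.
  set q : ℕ := A / 4
  have hq : (A : ℝ) / 8 ≤ q := by
    have : A ≤ 8 * q := by omega
    have : (A : ℝ) ≤ 8 * q := by exact_mod_cast this
    linarith
  have hterm : ∀ t : Fin A, (if (t : ℕ) < q then (q : ℝ) * (Real.exp (-a) / 2) else 0)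
      ≤ c.inputExpect Q (c.input star m t) (fun s _ => (((s : ℕ) - (t : ℕ) : ℕ) : ℝ)) := by
    intro t
    split_ifs with ht
    · have h1 := c.exp_neg_mul_inputExpect_le Q star hac (c.input star m t) a
        (f := fun s _ => if (s : ℕ) < A / 2 then 0 else 1)
        (fun _ _ => by split_ifs <;> norm_num) (fun _ _ => by split_ifs <;> norm_num)
      have h2 : Real.exp (-a) / 2 ≤ c.inputExpect Q (c.input star m t)
          (fun s _ => if (s : ℕ) < A / 2 then 0 else 1) := by
        refine le_trans ?_ h1
        have := hbad t
        have := Real.exp_pos (-a)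
        rw [div_eq_mul_one_div]
        exact mul_le_mul_of_nonneg_left (by linarith) this.le
      refine (mul_le_mul_of_nonneg_left h2 (Nat.cast_nonneg q)).trans ?_
      rw [← inputExpect_const_mul]
      refine c.inputExpect_mono Q _ fun s y => ?_
      split_ifs with hs
      · simp
      · rw [mul_one]
        exact_mod_cast (by omega : q ≤ (s : ℕ) - t)
    · exact c.inputExpect_nonneg Q _ fun _ _ => Nat.cast_nonneg _
  refine le_trans ?_ (Finset.sum_le_sum fun t _ => hterm t)
  rw [Fin.sum_univ_eq_sum_range (fun t => if t < q then (q : ℝ) * (Real.exp (-a) / 2) else 0) A,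
    ← Finset.sum_filter, Finset.sum_const, nsmul_eq_mul]
  have h2 : ((Finset.range A).filter fun t => t < q).card = q := by
    have : (Finset.range A).filter (fun t => t < q) = Finset.range q := by
      ext t; simp; omega
    rw [this, Finset.card_range]
  rw [h2]
  have := Real.exp_pos (-a)
  have h3 : (A : ℝ) ^ 2 / 64 ≤ q * q := by nlinarith
  nlinarith

end Code

end

/-! ### Upper bound on the exponent at positive rate. -/

section

variable {X Y : Type*}

/-- Distinct codewords give M ≤ |X|^n, so at a positive rate the delay is at most linear in n. -/
lemma Code.log_M_le [Fintype X] {n A : ℕ} (c : Code X Y n A) :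
    Real.log c.M ≤ n * Real.log (Fintype.card X) := by
  have h := Fintype.card_le_of_injective _ c.codeword_injective
  rw [Fintype.card_fin, Fintype.card_fun, Fintype.card_fin] at h
  rw [← Real.log_pow]
  have := c.two_le_M
  exact Real.log_le_log (by exact_mod_cast (by omega : 0 < c.M)) (by exact_mod_cast h)

variable [Fintype Y]

lemma eventually_mul_lt_exp (K : ℝ) {r : ℝ} (hr : 0 < r) :
    ∀ᶠ n : ℕ in atTop, K * n < Real.exp (r * n) := by
  -- The threshold comes from e^u ≥ u²/2 at u = rn.
  have h := tendsto_natCast_atTop_atTop (R := ℝ) |>.eventually_gt_atTop (2 * K / r ^ 2)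
  filter_upwards [h] with n hn
  have h1 := Real.quadratic_le_exp_of_nonneg (x := r * n) (by positivity)
  have h2 : K * 2 < n * r ^ 2 := by
    rw [div_lt_iff₀ (by positivity)] at hn; linarith
  have h3 : (0 : ℝ) ≤ n := Nat.cast_nonneg n
  nlinarith [mul_nonneg hr.le h3, mul_le_mul_of_nonneg_left h2.le h3]

lemma eventually_mul_exp_neg_le (K : ℝ) {r ε : ℝ} (hr : 0 < r) (hε : 0 < ε) :
    ∀ᶠ n : ℕ in atTop, K * n * Real.exp (-(r * n)) ≤ ε := by
  filter_upwards [eventually_mul_lt_exp (K / ε) hr] with n hn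
  rw [Real.exp_neg, ← div_eq_mul_inv, div_le_iff₀ (Real.exp_pos _)]
  rw [div_mul_eq_mul_div, div_lt_iff₀ hε] at hn
  linarith

lemma eventually_exp_neg_le {r ε : ℝ} (hr : 0 < r) (hε : 0 < ε) :
    ∀ᶠ n : ℕ in atTop, Real.exp (-(r * n)) ≤ ε := by
  filter_upwards [eventually_mul_exp_neg_le 1 hr hε, eventually_ge_atTop 1] with n hn h1
  have : (1 : ℝ) ≤ n := by exact_mod_cast h1
  nlinarith [Real.exp_pos (-(r * n))]

lemma eventually_sum_mul_exp_log_le (P P' : PMF Y) (hac : ∀ b, P' b = 0 → P b = 0) {μ : ℝ}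
    (hμ : (divergence P P').toReal < μ) :
    ∀ᶠ s : ℝ in 𝓝[>] 0, ∑ b, (P b).toReal * Real.exp (s * Real.log ((P b).toReal / (P' b).toReal))
      ≤ Real.exp (s * μ) :=
  eventually_sum_mul_exp_le _ _ (fun _ => ENNReal.toReal_nonneg) (toReal_pmf_sum P)
    ((divergence_eq_sum P P' hac).2 ▸ hμ)

/-- Large deviation bound for the log-likelihood ratio between noise and a codeword. -/
lemma noise_logLikelihood_tail_le {n A : ℕ} (c : Code X Y n A) (Q : X → PMF Y) (star : X)
    {s μ : ℝ} (hs : 0 ≤ s)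
    (hmgf : ∀ x, ∑ b, (Q star b).toReal *
      Real.exp (s * Real.log ((Q star b).toReal / (Q x b).toReal)) ≤ Real.exp (s * μ))
    (a : ℝ) (m : Fin c.M) (t : Fin A) :
    ∑ y : Fin (A + n - 1) → Y, (∏ i, (Q star (y i)).toReal) *
      (if a < ∑ i, Real.log ((Q star (y i)).toReal / (Q (c.input star m t i) (y i)).toReal)
        then 1 else 0) ≤ Real.exp (s * (n * μ - a)) := by
  refine (chernoff_bound (fun (_ : Fin (A + n - 1)) b => (Q star b).toReal)
    (fun i b => Real.log ((Q star b).toReal / (Q (c.input star m t i) b).toReal))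
    (fun _ _ => ENNReal.toReal_nonneg) hs a).trans ?_
  rw [c.prod_input star m t (fun x => ∑ b, (Q star b).toReal *
      Real.exp (s * Real.log ((Q star b).toReal / (Q x b).toReal)))
    (by simp [toReal_pmf_sum])]
  calc _ ≤ Real.exp (-(s * a)) * ∏ _k : Fin n, Real.exp (s * μ) := by
        refine mul_le_mul_of_nonneg_left (Finset.prod_le_prod (fun k _ => ?_) fun k _ => hmgf _)
          (Real.exp_pos _).le
        exact Finset.sum_nonneg fun b _ =>
          mul_nonneg ENNReal.toReal_nonneg (Real.exp_pos _).le
    _ = _ := by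
        rw [Finset.prod_const, Finset.card_univ, Fintype.card_fin, ← Real.exp_nat_mul,
          ← Real.exp_add]
        congr 1; ring

/-- At a positive rate the achievable exponents are at most the reverse divergence. -/
theorem le_maxReverseDivergence_of_achievable [Fintype X] (Q : X → PMF Y) (star : X)
    {R α : ℝ≥0} (hR : 0 < R) (h : Achievable Q star R α) :
    (α : ℝ≥0∞) ≤ maxReverseDivergence Q star := by
  by_contra! hlt
  have hdiv : ∀ x, divergence (Q star) (Q x) ≤ maxReverseDivergence Q star :=
    fun x => le_iSup (fun x => divergence (Q star) (Q x)) x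
  have htop : maxReverseDivergence Q star ≠ ∞ := (hlt.trans ENNReal.coe_lt_top).ne
  have hac : ∀ x b, Q x b = 0 → Q star b = 0 := fun x =>
    absolutelyContinuous_of_divergence_ne_top _ _ (ne_top_of_le_ne_top htop (hdiv x))
  set β : ℝ := (maxReverseDivergence Q star).toReal
  have hβα : β < α := by
    have := (ENNReal.toReal_lt_toReal htop ENNReal.coe_ne_top).2 hlt
    rwa [ENNReal.coe_toReal] at this
  obtain ⟨γ, hγ⟩ : ∃ γ : ℝ, γ = α - β := ⟨_, rfl⟩
  have hγ0 : 0 < γ := by linarith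
  have hR' : (0 : ℝ) < R := hR
  -- One s serves all symbols because the input alphabet is finite.
  obtain ⟨s, hs, hs0⟩ : ∃ s : ℝ, (∀ x, ∑ b, (Q star b).toReal *
      Real.exp (s * Real.log ((Q star b).toReal / (Q x b).toReal))
        ≤ Real.exp (s * (β + γ / 4))) ∧ 0 < s := by
    refine ((eventually_all.2 fun x => eventually_sum_mul_exp_log_le (Q star) (Q x) (hac x)
      ?_).and self_mem_nhdsWithin).exists
    have := ENNReal.toReal_mono htop (hdiv x)
    linarith
  set ε : ℝ := min (1 / 16) (min (R / 2) (γ / 4))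
  have hε : 0 < ε := by positivity
  have hε1 : ε ≤ 1 / 16 := min_le_left _ _
  have hε2 : ε ≤ R / 2 := (min_le_right _ _).trans (min_le_left _ _)
  have hε3 : ε ≤ γ / 4 := (min_le_right _ _).trans (min_le_right _ _)
  have hβ0 : 0 ≤ β := ENNReal.toReal_nonneg
  obtain ⟨n, hc, hn1, hn2, hn3⟩ := ((h ε hε).and
    ((eventually_mul_lt_exp (256 * Real.log (Fintype.card X) / R)
      (by positivity : 0 < γ / 4)).and
    ((eventually_exp_neg_le (by positivity : 0 < s * (γ / 4)) (by norm_num : (0 : ℝ) < 1 / 4)).and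
    (eventually_exp_neg_le (by positivity : 0 < γ / 4) (by norm_num : (0 : ℝ) < 1 / 8))))).exists
  obtain ⟨A, hA⟩ : ∃ A, A = ⌈Real.exp (((α : ℝ) - ε) * n)⌉₊ := ⟨_, rfl⟩
  rw [← hA] at hc
  obtain ⟨c, hrate, herr⟩ := hc
  have hn0 : (0 : ℝ) ≤ n := Nat.cast_nonneg n
  have hAexp : Real.exp (((α : ℝ) - ε) * n) ≤ A := hA ▸ Nat.le_ceil _
  have hA8 : (8 : ℝ) ≤ A := by
    have h1 : (8 : ℝ) ≤ Real.exp (γ / 4 * n) := by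
      rw [Real.exp_neg] at hn3
      have := inv_le_of_inv_le₀ (Real.exp_pos _) hn3
      linarith
    refine h1.trans (le_trans (Real.exp_le_exp.2 ?_) hAexp)
    exact mul_le_mul_of_nonneg_right (by linarith) hn0
  have hA8' : 8 ≤ A := by exact_mod_cast hA8
  have hA0 : 0 < A := by omega
  have herr' := (c.errorProb_le_iff Q star hA0 hε.le).1 herr
  have hr : 0 < (R : ℝ) - ε := by linarith
  have hM := c.two_le_M
  let m : Fin c.M := ⟨0, by omega⟩
  have hup := c.sum_delay_le_of_le_rate Q star hA0 hr hrate m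
  -- The cutoff n(β + γ/2) exceeds the bound n(β + γ/4) used in the exponential moment, making the
  -- tail small, and stays γn/4 below the lower bound for ln A.
  have hlow := c.delay_lower_bound Q star hac hA8' (n * (β + γ / 2))
    (fun m => (herr' m).trans (by gcongr)) m fun t =>
      (noise_logLikelihood_tail_le c Q star hs0.le hs _ m t).trans (le_trans (le_of_eq (by
        congr 1; ring)) hn2)
  have hlog0 : 0 ≤ Real.log c.M := Real.log_natCast_nonneg _
  have h1 : Real.log c.M / (R - ε) ≤ n * Real.log (Fintype.card X) / (R / 2) :=
    div_le_div₀ (hlog0.trans c.log_M_le) c.log_M_le (by positivity) (by linarith)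
  have h2 : (A : ℝ) * Real.exp (-(n * (β + γ / 2)))
      ≤ 256 * Real.log (Fintype.card X) / R * n := by
    have h3 := hlow.trans (hup.trans (mul_le_mul_of_nonneg_right h1 (Nat.cast_nonneg A)))
    have h4 : (A : ℝ) * (A * Real.exp (-(n * (β + γ / 2))))
        ≤ A * (256 * Real.log (Fintype.card X) / R * n) := by
      have : n * Real.log (Fintype.card X) / (R / 2) * A * 128
        = A * (256 * Real.log (Fintype.card X) / R * n) := by field_simp; ring
      nlinarith
    exact le_of_mul_le_mul_left h4 (by linarith)
  have h3 : Real.exp (γ / 4 * n) ≤ A * Real.exp (-(n * (β + γ / 2))) := by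
    refine le_trans ?_ (mul_le_mul_of_nonneg_right hAexp (Real.exp_pos _).le)
    rw [← Real.exp_add]
    refine Real.exp_le_exp.2 ?_
    have := mul_le_mul_of_nonneg_right hε3 hn0
    have : (α : ℝ) = β + γ := by linarith
    rw [this]
    nlinarith
  linarith

end

/-! ### Achievability at rate zero by burst codes. -/

section

variable {X Y : Type*}

/-- The channel input of a transmitter that repeats `x` in the `n` slots from `t` on. -/
def burst (star x : X) (n : ℕ) {A : ℕ} (t : Fin A) (i : Fin (A + n - 1)) : X :=
  if (t : ℕ) ≤ i ∧ (i : ℕ) < t + n then x else star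

open Classical in
/-- The code that sends either a burst of `x` or nothing at all. The decoder observes all outputs,
and declares a burst if for some starting time it is `exp b` times more likely than pure noise. -/
def burstCode (Q : X → PMF Y) (star x : X) (hx : x ≠ star) (n A : ℕ) (hn : 0 < n) (hA : 0 < A)
    (b : ℝ) : Code X Y n A where
  M := 2
  two_le_M := le_rfl
  codeword m _ := if m = 0 then x else star
  codeword_injective m m' h := by
    have h0 := congrFun h ⟨0, hn⟩
    fin_cases m <;> fin_cases m' <;> simp_all
  stopLaw _ := PMF.pure ⟨A + n - 1 - 1, by omega⟩
  stopLaw_adapted _ _ _ _ := rfl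
  -- The clause on `s` ensures adaptedness: only in the last slot does the decision look at the
  -- outputs.
  decision s y := if (s : ℕ) = A + n - 1 - 1 ∧ ∃ t : Fin A,
    Real.exp b * ∏ i, (Q star (y i)).toReal ≤ ∏ i, (Q (burst star x n t i) (y i)).toReal
    then 0 else 1
  decision_adapted s y y' h := by
    by_cases hs : (s : ℕ) = A + n - 1 - 1
    · have : y = y' := funext fun i => h i (by rw [Fin.le_def]; omega)
      rw [this]
    · simp [hs]

section

variable (Q : X → PMF Y) (star x : X) (hx : x ≠ star) (n A : ℕ) (hn : 0 < n) (hA : 0 < A) (b : ℝ)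

lemma burstCode_input_zero (t : Fin A) :
    (burstCode Q star x hx n A hn hA b).input star (0 : Fin 2) t = burst star x n t := by
  funext i
  simp only [Code.input, burstCode, burst]
  split_ifs <;> simp_all

lemma burstCode_input_one (t : Fin A) :
    (burstCode Q star x hx n A hn hA b).input star (1 : Fin 2) t = fun _ => star := by
  funext i
  simp only [Code.input, burstCode]
  split_ifs <;> simp_all

variable [Fintype Y]

lemma burstCode_inputExpect (u : Fin (A + n - 1) → X)
    (f : Fin (A + n - 1) → (Fin (A + n - 1) → Y) → ℝ) :
    (burstCode Q star x hx n A hn hA b).inputExpect Q u f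
      = ∑ y, (∏ i, (Q (u i) (y i)).toReal) * f ⟨A + n - 1 - 1, by omega⟩ y := by
  refine Finset.sum_congr rfl fun y _ => ?_
  congr 1
  rw [Finset.sum_eq_single ⟨A + n - 1 - 1, by omega⟩]
  · simp [burstCode]
  · intro s _ hs
    simp [burstCode, PMF.pure_apply, hs]
  · simp

/-- Where the test for t fires, the noise probability is at most e^{-b} times the burst-at-t
probability, which has total mass one. A union bound over t gives the factor A. -/
lemma burstCode_false_alarm_le (m : Fin (burstCode Q star x hx n A hn hA b).M) (hm : (m : ℕ) = 1)
    (t : Fin A) :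
    (burstCode Q star x hx n A hn hA b).inputExpect Q
      ((burstCode Q star x hx n A hn hA b).input star m t)
      (fun s y => if (burstCode Q star x hx n A hn hA b).decision s y = m then 0 else 1)
      ≤ A * Real.exp (-b) := by
  classical
  obtain rfl : m = (1 : Fin 2) := Fin.ext hm
  rw [burstCode_input_one, burstCode_inputExpect]
  calc _ ≤ ∑ y : Fin (A + n - 1) → Y, ∑ t : Fin A, Real.exp (-b) *
          ∏ i, (Q (burst star x n t i) (y i)).toReal := by
        refine Finset.sum_le_sum fun y _ => ?_
        have hnn : ∀ t ∈ Finset.univ, 0 ≤ Real.exp (-b) *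
            ∏ i, (Q (burst star x n (t : Fin A) i) (y i)).toReal := fun t _ =>
          mul_nonneg (Real.exp_pos _).le (Finset.prod_nonneg fun _ _ => ENNReal.toReal_nonneg)
        by_cases h : ∃ t : Fin A, Real.exp b * ∏ i, (Q star (y i)).toReal
            ≤ ∏ i, (Q (burst star x n t i) (y i)).toReal
        · obtain ⟨t, ht⟩ := id h
          refine le_trans ?_ (Finset.single_le_sum hnn (Finset.mem_univ t))
          have h2 := mul_le_mul_of_nonneg_left ht (Real.exp_pos (-b)).le
          rw [← mul_assoc, ← Real.exp_add, neg_add_cancel, Real.exp_zero, one_mul] at h2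
          simpa [burstCode, h] using h2
        · refine le_trans (le_of_eq ?_) (Finset.sum_nonneg hnn)
          simp [burstCode, h]
    _ = A * Real.exp (-b) := by
        rw [Finset.sum_comm]
        simp_rw [← Finset.mul_sum]
        rw [Finset.sum_congr rfl fun t _ => by
          rw [sum_prod_eq_one (fun i b => (Q (burst star x n t i) b).toReal)
            fun i => toReal_pmf_sum _]]
        simp [mul_comm]

/-- The true start time is among those tested, so a miss means that its own test failed. -/
lemma burstCode_miss_le (m : Fin (burstCode Q star x hx n A hn hA b).M) (hm : (m : ℕ) = 0)
    (t : Fin A) :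
    (burstCode Q star x hx n A hn hA b).inputExpect Q
      ((burstCode Q star x hx n A hn hA b).input star m t)
      (fun s y => if (burstCode Q star x hx n A hn hA b).decision s y = m then 0 else 1)
      ≤ ∑ y : Fin (A + n - 1) → Y, (∏ i, (Q (burst star x n t i) (y i)).toReal) *
        (if ∏ i, (Q (burst star x n t i) (y i)).toReal < Real.exp b * ∏ i, (Q star (y i)).toReal
          then 1 else 0) := by
  classical
  obtain rfl : m = (0 : Fin 2) := Fin.ext hm
  rw [burstCode_input_zero, burstCode_inputExpect]
  refine Finset.sum_le_sum fun y _ => mul_le_mul_of_nonneg_left ?_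
    (Finset.prod_nonneg fun _ _ => ENNReal.toReal_nonneg)
  split_ifs with h1 h2 h2
  · norm_num
  · exact le_rfl
  · exact le_rfl
  · refine absurd ?_ h1
    simp only [burstCode, true_and]
    exact if_pos ⟨t, not_lt.1 h2⟩

end

lemma prod_burst (star x : X) (n : ℕ) {A : ℕ} (t : Fin A) (F : X → ℝ) (hF : F star = 1) :
    ∏ i, F (burst star x n t i) = F x ^ n := by
  trans ∏ _k : Fin n, F x
  swap
  · simp
  symm
  refine Finset.prod_of_injOn (fun k : Fin n => (⟨t + k, by omega⟩ : Fin (A + n - 1))) ?_ ?_ ?_ ?_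
  · intro k _ k' _ h
    simpa [Fin.ext_iff] using h
  · intro k _; simp
  · intro i _ hi
    rw [burst, if_neg, hF]
    rintro ⟨h1, h2⟩
    refine hi ⟨⟨i - t, by omega⟩, by simp, ?_⟩
    ext; simp; omega
  · intro k _
    rw [burst, if_pos ⟨by simp, by simp⟩]

variable [Fintype Y]

/-- A burst looks less than `exp (n b)` times more likely than noise with exponentially small
probability, for some `b` exceeding any given number below the divergence. -/
lemma exists_burst_miss_bound (Q : X → PMF Y) (star x : X) {α : ℝ≥0}
    (hα : (α : ℝ≥0∞) < divergence (Q x) (Q star)) :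
    ∃ b : ℝ, α < b ∧ ∃ r : ℝ, 0 < r ∧ ∀ (n A : ℕ) (t : Fin A),
      ∑ y : Fin (A + n - 1) → Y, (∏ i, (Q (burst star x n t i) (y i)).toReal) *
        (if ∏ i, (Q (burst star x n t i) (y i)).toReal
            < Real.exp (n * b) * ∏ i, (Q star (y i)).toReal then 1 else 0)
        ≤ Real.exp (-(r * n)) := by
  classical
  by_cases hac : ∀ b, Q star b = 0 → Q x b = 0
  · obtain ⟨htop, hdiv⟩ := divergence_eq_sum (Q x) (Q star) hac
    have hα' : (α : ℝ) < (divergence (Q x) (Q star)).toReal := by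
      have := (ENNReal.toReal_lt_toReal ENNReal.coe_ne_top htop).2 hα
      rwa [ENNReal.coe_toReal] at this
    -- The gap from the divergence to b' controls the exponential moment, and the gap from b' to b
    -- yields the decay rate s(b' - b).
    obtain ⟨b', hb'1, hb'2⟩ := exists_between hα'
    obtain ⟨b, hb1, hb2⟩ := exists_between hb'1
    have hmean : ∑ y, (Q x y).toReal * (-Real.log ((Q x y).toReal / (Q star y).toReal)) < -b' := by
      simp only [mul_neg, Finset.sum_neg_distrib]
      rw [← hdiv]; linarith
    obtain ⟨s, hs, hs0⟩ := ((eventually_sum_mul_exp_le _ _ (fun _ => ENNReal.toReal_nonneg)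
      (toReal_pmf_sum (Q x)) hmean).and self_mem_nhdsWithin).exists
    have hs0 : 0 < s := hs0
    refine ⟨b, hb1, s * (b' - b), mul_pos hs0 (by linarith), fun n A t => ?_⟩
    have hac' : ∀ (i : Fin (A + n - 1)) z, Q star z = 0 → Q (burst star x n t i) z = 0 := by
      intro i z hz
      rw [burst]; split_ifs
      · exact hac z hz
      · exact hz
    have hch := chernoff_bound
      (fun (i : Fin (A + n - 1)) z => (Q (burst star x n t i) z).toReal)
      (fun i z => -Real.log ((Q (burst star x n t i) z).toReal / (Q star z).toReal))
      (fun _ _ => ENNReal.toReal_nonneg) hs0.le (-(n * b))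
    rw [prod_burst star x n t (fun x => ∑ z, (Q x z).toReal *
      Real.exp (s * (-Real.log ((Q x z).toReal / (Q star z).toReal))))
      (by simp [toReal_pmf_sum])] at hch
    refine (le_trans (Finset.sum_le_sum fun y _ => ?_) hch).trans ?_
    · have hw : 0 ≤ ∏ i, (Q (burst star x n t i) (y i)).toReal :=
        Finset.prod_nonneg fun _ _ => ENNReal.toReal_nonneg
      by_cases hz : ∏ i, (Q (burst star x n t i) (y i)).toReal = 0
      · simp [hz]
      refine mul_le_mul_of_nonneg_left ?_ hw
      have hpos : ∀ i, 0 < (Q (burst star x n t i) (y i)).toReal := fun i =>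
        lt_of_le_of_ne ENNReal.toReal_nonneg
          (Ne.symm (Finset.prod_ne_zero_iff.1 hz i (Finset.mem_univ i)))
      have hpos' : ∀ i, 0 < (Q star (y i)).toReal := fun i =>
        ENNReal.toReal_pos (fun h => (hpos i).ne' (by rw [hac' i _ h, ENNReal.toReal_zero]))
          (PMF.apply_ne_top _ _)
      split_ifs with h1 h2
      · exact le_rfl
      · refine absurd ?_ h2
        rw [Finset.sum_neg_distrib, neg_lt_neg_iff, ← Real.exp_lt_exp, Real.exp_sum]
        simp_rw [fun i => Real.exp_log (div_pos (hpos i) (hpos' i))]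
        rw [Finset.prod_div_distrib, div_lt_iff₀ (Finset.prod_pos fun i _ => hpos' i)]
        exact h1
      · norm_num
      · exact le_rfl
    · calc _ ≤ Real.exp (-(s * -(n * b))) * Real.exp (s * -b') ^ n := by
            refine mul_le_mul_of_nonneg_left (pow_le_pow_left₀ ?_ hs n) (Real.exp_pos _).le
            exact Finset.sum_nonneg fun _ _ =>
              mul_nonneg ENNReal.toReal_nonneg (Real.exp_pos _).le
        _ = _ := by
            rw [← Real.exp_nat_mul, ← Real.exp_add]
            congr 1; ring
  -- Infinite divergence: x can produce a symbol impossible under noise. A miss requires that no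
  -- such symbol appears, so it has probability at most ρ^n, whatever b is.
  · push Not at hac
    obtain ⟨z₀, hz₀, hz₀'⟩ := hac
    set ρ : ℝ := ∑ z, (Q x z).toReal * (if (Q star z).toReal = 0 then 0 else 1)
    have hρ1 : ρ < 1 := by
      rw [← toReal_pmf_sum (Q x)]
      refine Finset.sum_lt_sum (fun z _ => ?_) ⟨z₀, Finset.mem_univ _, ?_⟩
      · refine mul_le_of_le_one_right ENNReal.toReal_nonneg ?_
        split_ifs <;> norm_num
      · simpa [hz₀] using ENNReal.toReal_pos hz₀' (PMF.apply_ne_top _ _)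
    have hρ0 : 0 ≤ ρ := Finset.sum_nonneg fun z _ =>
      mul_nonneg ENNReal.toReal_nonneg (by split_ifs <;> norm_num)
    refine ⟨α + 1, by linarith, 1 - ρ, by linarith, fun n A t => ?_⟩
    calc _ ≤ ∑ y : Fin (A + n - 1) → Y, ∏ i, (Q (burst star x n t i) (y i)).toReal *
            (if (Q star (y i)).toReal = 0 then 0 else 1) := by
          refine Finset.sum_le_sum fun y _ => ?_
          rw [Finset.prod_mul_distrib]
          refine mul_le_mul_of_nonneg_left ?_
            (Finset.prod_nonneg fun _ _ => ENNReal.toReal_nonneg)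
          split_ifs with h
          · refine le_of_eq (Finset.prod_eq_one fun i _ => if_neg fun hi => ?_).symm
            rw [Finset.prod_eq_zero (f := fun i => (Q star (y i)).toReal) (Finset.mem_univ i) hi,
              mul_zero] at h
            exact absurd h (not_lt.2 (Finset.prod_nonneg fun _ _ => ENNReal.toReal_nonneg))
          · exact Finset.prod_nonneg fun _ _ => by split_ifs <;> norm_num
      _ = ρ ^ n := by
          rw [sum_prod_eq (fun i z => (Q (burst star x n t i) z).toReal *
            (if (Q star z).toReal = 0 then 0 else 1))]
          refine prod_burst star x n t (fun x => ∑ z, (Q x z).toReal *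
            (if (Q star z).toReal = 0 then 0 else 1)) ?_
          refine Eq.trans ?_ (toReal_pmf_sum (Q star))
          refine Finset.sum_congr rfl fun z _ => ?_
          split_ifs with h <;> simp [h]
      _ ≤ Real.exp (-(1 - ρ)) ^ n := by
          refine pow_le_pow_left₀ hρ0 ?_ n
          have := Real.add_one_le_exp (-(1 - ρ))
          linarith
      _ = _ := by rw [← Real.exp_nat_mul]; congr 1; ring

/-- At rate zero every exponent below the synchronization threshold is achievable. -/
theorem achievable_zero_of_lt_syncThreshold (Q : X → PMF Y) (star : X) {α : ℝ≥0}
    (hα : (α : ℝ≥0∞) < syncThreshold Q star) : Achievable Q star 0 α := by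
  obtain ⟨x, hx⟩ := lt_iSup_iff.1 hα
  have hxs : x ≠ star := by
    rintro rfl
    simp [divergence, InformationTheory.klDiv_self] at hx
  obtain ⟨b, hb, r, hr, hmiss⟩ := exists_burst_miss_bound Q star x hx
  intro ε hε
  filter_upwards [eventually_exp_neg_le hr hε,
    eventually_exp_neg_le (sub_pos.2 hb) (half_pos hε), eventually_gt_atTop 0] with n h1 h2 hn
  obtain ⟨A, hAdef⟩ : ∃ A, A = ⌈Real.exp (((α : ℝ) - ε) * n)⌉₊ := ⟨_, rfl⟩
  rw [← hAdef]
  have hn0 : (0 : ℝ) ≤ n := Nat.cast_nonneg n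
  have hA : 0 < A := hAdef ▸ Nat.ceil_pos.2 (Real.exp_pos _)
  -- Rounding up adds at most 1 ≤ e^{αn}, also when α - ε is negative.
  have hA2 : (A : ℝ) ≤ 2 * Real.exp (α * n) := by
    have h3 : (A : ℝ) < Real.exp (((α : ℝ) - ε) * n) + 1 :=
      hAdef ▸ Nat.ceil_lt_add_one (Real.exp_pos _).le
    have h4 : Real.exp (((α : ℝ) - ε) * n) ≤ Real.exp (α * n) :=
      Real.exp_le_exp.2 (mul_le_mul_of_nonneg_right (by linarith) hn0)
    have h5 : 1 ≤ Real.exp (α * n) := Real.one_le_exp (mul_nonneg α.2 hn0)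
    linarith
  refine ⟨burstCode Q star x hxs n A hn hA (n * b), ?_, ?_⟩
  -- At R = 0 the required rate is negative, so the delay is irrelevant.
  · rw [ENNReal.ofReal_of_nonpos (by simpa using hε.le)]
    exact zero_le
  · rw [Code.errorProb_le_iff _ _ _ hA hε.le]
    change ∀ m : Fin 2, _
    have hsum : ∀ f : Fin A → ℝ, (∀ t, f t ≤ ε) → ∑ t, f t ≤ ε * A := fun f hf =>
      (Finset.sum_le_sum fun t _ => hf t).trans (le_of_eq (by simp [mul_comm]))
    rw [Fin.forall_fin_two]
    refine ⟨hsum _ fun t => ?_, hsum _ fun t => ?_⟩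
    · exact (burstCode_miss_le Q star x hxs n A hn hA (n * b) _ rfl t).trans ((hmiss n A t).trans h1)
    · refine (burstCode_false_alarm_le Q star x hxs n A hn hA (n * b) _ rfl t).trans ?_
      calc (A : ℝ) * Real.exp (-(n * b)) ≤ 2 * Real.exp (α * n) * Real.exp (-(n * b)) :=
            mul_le_mul_of_nonneg_right hA2 (Real.exp_pos _).le
        _ = 2 * Real.exp (-((b - α) * n)) := by
            rw [mul_assoc, ← Real.exp_add]; congr 2; ring
        _ ≤ ε := by linarith

end

/-! ### Upper bound at rate zero by the second-moment method. -/

section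

variable {X Y : Type*}

/-- If the average of the `Z t` has mean close to `1` and second moment close to `1` under `w`, then
it is close to a density equal to `1`. -/
lemma sum_mul_le_of_second_moment {Ω T : Type*} [Fintype Ω] [Fintype T] [Nonempty T] (w : Ω → ℝ)
    (hw : ∀ ω, 0 ≤ w ω) (hw1 : ∑ ω, w ω = 1) (Z : T → Ω → ℝ) {η κ l : ℝ} (hl : 0 < l)
    (h1 : (1 - η) * Fintype.card T ≤ ∑ t, ∑ ω, w ω * Z t ω)
    (h2 : ∑ t, ∑ t', ∑ ω, w ω * (Z t ω * Z t' ω) ≤ (1 + κ) * (Fintype.card T : ℝ) ^ 2)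
    (g : Ω → ℝ) (hg0 : ∀ ω, 0 ≤ g ω) (hg1 : ∀ ω, g ω ≤ 1) :
    ∑ ω, w ω * g ω ≤ (∑ t, ∑ ω, w ω * Z t ω * g ω) / Fintype.card T + l
      + (2 * η + κ) / (4 * l) := by
  have hN : (0 : ℝ) < Fintype.card T := by exact_mod_cast Fintype.card_pos
  set N : ℝ := (Fintype.card T : ℝ)
  set V : Ω → ℝ := fun ω => (∑ t, Z t ω) / N
  have hEV : 1 - η ≤ ∑ ω, w ω * V ω := by
    have : ∑ ω, w ω * V ω = (∑ t, ∑ ω, w ω * Z t ω) / N := by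
      rw [Finset.sum_comm, Finset.sum_div]
      refine Finset.sum_congr rfl fun ω _ => ?_
      rw [← Finset.mul_sum, mul_div_assoc]
    rwa [this, le_div_iff₀ hN]
  have hEV2 : ∑ ω, w ω * V ω ^ 2 ≤ 1 + κ := by
    have : ∑ ω, w ω * V ω ^ 2 = (∑ t, ∑ t', ∑ ω, w ω * (Z t ω * Z t' ω)) / N ^ 2 := by
      simp_rw [Finset.sum_comm (s := (Finset.univ : Finset T)) (t := (Finset.univ : Finset Ω))]
      rw [Finset.sum_div]
      refine Finset.sum_congr rfl fun ω _ => ?_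
      simp only [V, div_pow, sq (∑ t, Z t ω), Finset.sum_mul_sum, ← Finset.mul_sum]
      rw [mul_div_assoc]
    rwa [this, div_le_iff₀ (by positivity)]
  have hg : ∑ ω, w ω * V ω * g ω = (∑ t, ∑ ω, w ω * Z t ω * g ω) / N := by
    rw [Finset.sum_comm, Finset.sum_div]
    refine Finset.sum_congr rfl fun ω _ => ?_
    rw [← Finset.sum_mul, ← Finset.mul_sum]
    simp only [V]; ring
  have hpt : ∀ ω, w ω * g ω ≤ w ω * V ω * g ω + w ω * l
      + (w ω - 2 * (w ω * V ω) + w ω * V ω ^ 2) * (1 / (4 * l)) := by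
    intro ω
    -- The arithmetic-geometric inequality replaces Cauchy–Schwarz, and the mean of (1 - V)² is at
    -- most 1 - 2(1 - η) + 1 + κ = 2η + κ.
    have hsq : 1 - V ω ≤ l + (1 - V ω) ^ 2 * (1 / (4 * l)) := by
      have : l + (1 - V ω) ^ 2 * (1 / (4 * l)) - (1 - V ω)
        = (2 * l - (1 - V ω)) ^ 2 / (4 * l) := by field_simp; ring
      have : 0 ≤ (2 * l - (1 - V ω)) ^ 2 / (4 * l) := by positivity
      linarith
    have hnn : 0 ≤ l + (1 - V ω) ^ 2 * (1 / (4 * l)) := by positivity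
    have : (1 - V ω) * g ω ≤ l + (1 - V ω) ^ 2 * (1 / (4 * l)) :=
      (mul_le_mul_of_nonneg_right hsq (hg0 ω)).trans (mul_le_of_le_one_right hnn (hg1 ω))
    have := mul_le_mul_of_nonneg_left this (hw ω)
    nlinarith
  calc ∑ ω, w ω * g ω ≤ ∑ ω, (w ω * V ω * g ω + w ω * l
      + (w ω - 2 * (w ω * V ω) + w ω * V ω ^ 2) * (1 / (4 * l))) :=
        Finset.sum_le_sum fun ω _ => hpt ω
    _ = ∑ ω, w ω * V ω * g ω + l
        + (1 - 2 * ∑ ω, w ω * V ω + ∑ ω, w ω * V ω ^ 2) * (1 / (4 * l)) := by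
        rw [Finset.sum_add_distrib, Finset.sum_add_distrib, ← Finset.sum_mul, ← Finset.sum_mul, hw1,
          Finset.sum_add_distrib, Finset.sum_sub_distrib, ← Finset.mul_sum, hw1, one_mul]
    _ ≤ _ := by
        rw [hg, div_eq_mul_one_div (2 * η + κ)]
        have : 0 ≤ 1 / (4 * l) := by positivity
        have h3 : 1 - 2 * ∑ ω, w ω * V ω + ∑ ω, w ω * V ω ^ 2 ≤ 2 * η + κ := by linarith
        linarith [mul_le_mul_of_nonneg_right h3 this]

namespace Code

variable {n A : ℕ} (c : Code X Y n A) (Q : X → PMF Y) (star : X)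

lemma input_eq_star_or_input_eq_star (m : Fin c.M) {t t' : Fin A}
    (h : (t : ℕ) + n ≤ t' ∨ (t' : ℕ) + n ≤ t) (i : Fin (A + n - 1)) :
    c.input star m t i = star ∨ c.input star m t' i = star := by
  by_cases h1 : (t : ℕ) ≤ i ∧ (i : ℕ) < t + n
  · right; rw [input, dif_neg (by omega)]
  · left; rw [input, dif_neg h1]

/-- The likelihood ratio between a codeword sent at time `t` and noise. -/
def likelihood (m : Fin c.M) (t : Fin A) (y : Fin (A + n - 1) → Y) : ℝ :=
  ∏ i, (Q (c.input star m t i) (y i)).toReal / (Q star (y i)).toReal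

/-- The likelihood ratio, replaced by `0` where its logarithm is larger than `a`. -/
def truncLikelihood (a : ℝ) (m : Fin c.M) (t : Fin A) (y : Fin (A + n - 1) → Y) : ℝ :=
  if a < ∑ i, Real.log ((Q (c.input star m t i) (y i)).toReal / (Q star (y i)).toReal) then 0
  else c.likelihood Q star m t y

lemma likelihood_nonneg (m : Fin c.M) (t : Fin A) (y : Fin (A + n - 1) → Y) :
    0 ≤ c.likelihood Q star m t y :=
  Finset.prod_nonneg fun _ _ => div_nonneg ENNReal.toReal_nonneg ENNReal.toReal_nonneg

lemma truncLikelihood_nonneg (a : ℝ) (m : Fin c.M) (t : Fin A) (y : Fin (A + n - 1) → Y) :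
    0 ≤ c.truncLikelihood Q star a m t y := by
  rw [truncLikelihood]; split_ifs
  · exact le_rfl
  · exact c.likelihood_nonneg Q star m t y

lemma truncLikelihood_le_likelihood (a : ℝ) (m : Fin c.M) (t : Fin A)
    (y : Fin (A + n - 1) → Y) :
    c.truncLikelihood Q star a m t y ≤ c.likelihood Q star m t y := by
  rw [truncLikelihood]; split_ifs
  · exact c.likelihood_nonneg Q star m t y
  · exact le_rfl

lemma truncLikelihood_le_exp (a : ℝ) (m : Fin c.M) (t : Fin A) (y : Fin (A + n - 1) → Y) :
    c.truncLikelihood Q star a m t y ≤ Real.exp a := by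
  rw [truncLikelihood]; split_ifs with h
  · exact (Real.exp_pos a).le
  · refine le_trans ?_ (Real.exp_le_exp.2 (not_lt.1 h))
    rw [Real.exp_sum]
    exact Finset.prod_le_prod
      (fun _ _ => div_nonneg ENNReal.toReal_nonneg ENNReal.toReal_nonneg) fun i _ =>
        -- Only an inequality is available for a zero ratio, since `Real.log 0 = 0`.
        Real.le_exp_log _

variable {Q star}

lemma prod_mul_likelihood (hac : ∀ x b, Q star b = 0 → Q x b = 0) (m : Fin c.M) (t : Fin A)
    (y : Fin (A + n - 1) → Y) :
    (∏ i, (Q star (y i)).toReal) * c.likelihood Q star m t y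
      = ∏ i, (Q (c.input star m t i) (y i)).toReal := by
  rw [likelihood, ← Finset.prod_mul_distrib]
  refine Finset.prod_congr rfl fun i _ => ?_
  by_cases h : Q star (y i) = 0
  · simp [h, hac _ _ h]
  · rw [mul_div_cancel₀]
    exact (ENNReal.toReal_pos h (PMF.apply_ne_top _ _)).ne'

variable [Fintype Y]

lemma sum_mul_likelihood (hac : ∀ x b, Q star b = 0 → Q x b = 0) (m : Fin c.M) (t : Fin A) :
    ∑ y : Fin (A + n - 1) → Y, (∏ i, (Q star (y i)).toReal) * c.likelihood Q star m t y = 1 := by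
  simp_rw [c.prod_mul_likelihood hac]
  exact sum_prod_eq_one (fun i b => (Q (c.input star m t i) b).toReal) fun i => toReal_pmf_sum _

/-- When the two windows are disjoint, each slot has a silent input on at least one side, so the
product of the ratios is again a density with respect to the noise law. -/
lemma sum_mul_likelihood_mul_likelihood (hac : ∀ x b, Q star b = 0 → Q x b = 0) (m : Fin c.M)
    {t t' : Fin A} (h : (t : ℕ) + n ≤ t' ∨ (t' : ℕ) + n ≤ t) :
    ∑ y : Fin (A + n - 1) → Y, (∏ i, (Q star (y i)).toReal) *
      (c.likelihood Q star m t y * c.likelihood Q star m t' y) = 1 := by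
  have hone : ∀ x, ∑ b, (Q star b).toReal * ((Q x b).toReal / (Q star b).toReal) = 1 := by
    intro x
    refine Eq.trans (Finset.sum_congr rfl fun b _ => ?_) (toReal_pmf_sum (Q x))
    by_cases hb : Q star b = 0
    · simp [hb, hac x b hb]
    · rw [mul_div_cancel₀]
      exact (ENNReal.toReal_pos hb (PMF.apply_ne_top _ _)).ne'
  -- The noise-to-noise ratio is 0, not 1, off the support, so it can be cancelled only against the
  -- noise weight.
  have hself : ∀ b, (Q star b).toReal * ((Q star b).toReal / (Q star b).toReal)
      = (Q star b).toReal := fun b => by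
    by_cases hb : (Q star b).toReal = 0
    · simp [hb]
    · field_simp
  simp_rw [likelihood, ← Finset.prod_mul_distrib]
  refine sum_prod_eq_one (fun i b => (Q star b).toReal *
    ((Q (c.input star m t i) b).toReal / (Q star b).toReal *
      ((Q (c.input star m t' i) b).toReal / (Q star b).toReal))) fun i => ?_
  rcases c.input_eq_star_or_input_eq_star star m h i with h1 | h1
  · rw [h1, ← hone (c.input star m t' i)]
    refine Finset.sum_congr rfl fun b _ => ?_
    rw [← mul_assoc, hself]
  · rw [h1, ← hone (c.input star m t i)]
    refine Finset.sum_congr rfl fun b _ => ?_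
    rw [mul_comm (_ / _), ← mul_assoc, hself]

lemma card_near_le (t : Fin A) :
    ((Finset.univ : Finset (Fin A)).filter
      fun t' : Fin A => ¬ ((t : ℕ) + n ≤ t' ∨ (t' : ℕ) + n ≤ t)).card ≤ 2 * n := by
  calc _ ≤ (Finset.Ico ((t : ℕ) - n) (t + n)).card := by
        refine Finset.card_le_card_of_injOn (fun t' : Fin A => (t' : ℕ)) ?_
          Fin.val_injective.injOn
        intro t' ht'
        simp at ht' ⊢
        omega
    _ ≤ 2 * n := by rw [Nat.card_Ico]; omega

/-- Pairs with disjoint windows contribute at most 1 each. At most 2nA pairs overlap, and for them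
one factor is at most e^a by truncation while the other has mean at most 1. -/
lemma second_moment_truncLikelihood_le (hac : ∀ x b, Q star b = 0 → Q x b = 0) (hA : 0 < A)
    (a : ℝ) (m : Fin c.M) :
    ∑ t, ∑ t', ∑ y : Fin (A + n - 1) → Y, (∏ i, (Q star (y i)).toReal) *
      (c.truncLikelihood Q star a m t y * c.truncLikelihood Q star a m t' y)
      ≤ (1 + 2 * n * Real.exp a / A) * (A : ℝ) ^ 2 := by
  classical
  have hw : ∀ y : Fin (A + n - 1) → Y, 0 ≤ ∏ i, (Q star (y i)).toReal := fun y =>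
    Finset.prod_nonneg fun _ _ => ENNReal.toReal_nonneg
  have hpair : ∀ t t' : Fin A, ∑ y : Fin (A + n - 1) → Y, (∏ i, (Q star (y i)).toReal) *
      (c.truncLikelihood Q star a m t y * c.truncLikelihood Q star a m t' y)
      ≤ 1 + if ¬ ((t : ℕ) + n ≤ t' ∨ (t' : ℕ) + n ≤ t) then Real.exp a else 0 := by
    intro t t'
    by_cases h : ¬ ((t : ℕ) + n ≤ t' ∨ (t' : ℕ) + n ≤ t)
    · rw [if_pos h]
      calc _ ≤ ∑ y : Fin (A + n - 1) → Y, (∏ i, (Q star (y i)).toReal) *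
            (c.likelihood Q star m t y) * Real.exp a := by
            refine Finset.sum_le_sum fun y _ => ?_
            rw [mul_assoc]
            exact mul_le_mul_of_nonneg_left (mul_le_mul
              (c.truncLikelihood_le_likelihood Q star a m t y)
              (c.truncLikelihood_le_exp Q star a m t' y)
              (c.truncLikelihood_nonneg Q star a m t' y)
              (c.likelihood_nonneg Q star m t y)) (hw y)
        _ ≤ _ := by
            rw [← Finset.sum_mul, c.sum_mul_likelihood hac]
            linarith
    · rw [if_neg h, add_zero, ← c.sum_mul_likelihood_mul_likelihood hac m (not_not.1 h)]
      refine Finset.sum_le_sum fun y _ => mul_le_mul_of_nonneg_left (mul_le_mul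
        (c.truncLikelihood_le_likelihood Q star a m t y)
        (c.truncLikelihood_le_likelihood Q star a m t' y)
        (c.truncLikelihood_nonneg Q star a m t' y)
        (c.likelihood_nonneg Q star m t y)) (hw y)
  have hAr : (0 : ℝ) < A := by exact_mod_cast hA
  calc _ ≤ ∑ _t : Fin A, ((A : ℝ) + 2 * n * Real.exp a) := by
        refine Finset.sum_le_sum fun t _ => ?_
        refine (Finset.sum_le_sum fun t' _ => hpair t t').trans ?_
        rw [Finset.sum_add_distrib, ← Finset.sum_filter, Finset.sum_const, Finset.sum_const,
          Finset.card_univ, Fintype.card_fin, nsmul_eq_mul, mul_one, nsmul_eq_mul]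
        have : (((Finset.univ : Finset (Fin A)).filter
          fun t' : Fin A => ¬ ((t : ℕ) + n ≤ t' ∨ (t' : ℕ) + n ≤ t)).card : ℝ) ≤ 2 * n := by
          exact_mod_cast card_near_le t
        linarith [mul_le_mul_of_nonneg_right this (Real.exp_pos a).le]
    _ = _ := by
        rw [Finset.sum_const, Finset.card_univ, Fintype.card_fin, nsmul_eq_mul]
        field_simp

/-- The mass lost by truncation is the probability, when m is sent at t, that the log-likelihood
ratio exceeds a. A Chernoff bound over the n codeword slots controls it. -/
lemma one_sub_le_sum_mul_truncLikelihood (hac : ∀ x b, Q star b = 0 → Q x b = 0) {s μ : ℝ}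
    (hs : 0 ≤ s) (hmgf : ∀ x, ∑ b, (Q x b).toReal *
      Real.exp (s * Real.log ((Q x b).toReal / (Q star b).toReal)) ≤ Real.exp (s * μ))
    (a : ℝ) (m : Fin c.M) (t : Fin A) :
    1 - Real.exp (s * (n * μ - a)) ≤ ∑ y : Fin (A + n - 1) → Y,
      (∏ i, (Q star (y i)).toReal) * c.truncLikelihood Q star a m t y := by
  have hch := chernoff_bound (fun (i : Fin (A + n - 1)) b => (Q (c.input star m t i) b).toReal)
    (fun i b => Real.log ((Q (c.input star m t i) b).toReal / (Q star b).toReal))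
    (fun _ _ => ENNReal.toReal_nonneg) hs a
  rw [c.prod_input star m t (fun x => ∑ b, (Q x b).toReal *
      Real.exp (s * Real.log ((Q x b).toReal / (Q star b).toReal)))
    (by simp [toReal_pmf_sum])] at hch
  have h1 : Real.exp (-(s * a)) * ∏ k, ∑ b, (Q (c.codeword m k) b).toReal *
      Real.exp (s * Real.log ((Q (c.codeword m k) b).toReal / (Q star b).toReal))
      ≤ Real.exp (s * (n * μ - a)) := by
    calc _ ≤ Real.exp (-(s * a)) * ∏ _k : Fin n, Real.exp (s * μ) := by
          refine mul_le_mul_of_nonneg_left (Finset.prod_le_prod (fun k _ => ?_)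
            fun k _ => hmgf _) (Real.exp_pos _).le
          exact Finset.sum_nonneg fun b _ =>
            mul_nonneg ENNReal.toReal_nonneg (Real.exp_pos _).le
      _ = _ := by
          rw [Finset.prod_const, Finset.card_univ, Fintype.card_fin, ← Real.exp_nat_mul,
            ← Real.exp_add]
          congr 1; ring
  have h2 : ∑ y : Fin (A + n - 1) → Y,
      (∏ i, (Q star (y i)).toReal) * c.truncLikelihood Q star a m t y = 1 -
      ∑ y : Fin (A + n - 1) → Y, (∏ i, (Q (c.input star m t i) (y i)).toReal) *
        (if a < ∑ i, Real.log ((Q (c.input star m t i) (y i)).toReal / (Q star (y i)).toReal)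
          then 1 else 0) := by
    refine Eq.trans ?_ (congrArg (· - _) (c.sum_mul_likelihood hac m t))
    rw [← Finset.sum_sub_distrib]
    refine Finset.sum_congr rfl fun y _ => ?_
    rw [← c.prod_mul_likelihood hac, truncLikelihood]
    split_ifs <;> ring
  rw [h2]
  linarith

/-- The law of the output when `m` is sent at a uniformly random time is close to the noise law. -/
lemma inputExpect_star_le (hac : ∀ x b, Q star b = 0 → Q x b = 0) (hA : 0 < A) {s μ : ℝ}
    (hs : 0 ≤ s) (hmgf : ∀ x, ∑ b, (Q x b).toReal *
      Real.exp (s * Real.log ((Q x b).toReal / (Q star b).toReal)) ≤ Real.exp (s * μ))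
    (a : ℝ) {l : ℝ} (hl : 0 < l) (m : Fin c.M)
    {f : Fin (A + n - 1) → (Fin (A + n - 1) → Y) → ℝ} (hf0 : ∀ s y, 0 ≤ f s y)
    (hf1 : ∀ s y, f s y ≤ 1) :
    c.inputExpect Q (fun _ => star) f
      ≤ (∑ t, c.inputExpect Q (c.input star m t) f) / A + l
        + (2 * Real.exp (s * (n * μ - a)) + 2 * n * Real.exp a / A) / (4 * l) := by
  have : Nonempty (Fin A) := ⟨⟨0, hA⟩⟩
  have hw : ∀ y : Fin (A + n - 1) → Y, 0 ≤ ∏ i, (Q star (y i)).toReal := fun y =>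
    Finset.prod_nonneg fun _ _ => ENNReal.toReal_nonneg
  have h := sum_mul_le_of_second_moment (fun y : Fin (A + n - 1) → Y => ∏ i, (Q star (y i)).toReal)
    hw (sum_prod_eq_one (fun _ b => (Q star b).toReal) fun _ => toReal_pmf_sum _)
    (fun t y => c.truncLikelihood Q star a m t y)
    (η := Real.exp (s * (n * μ - a))) (κ := 2 * n * Real.exp a / A) hl
    ?_ ?_ _ (c.sum_stopLaw_mul_nonneg hf0) (c.sum_stopLaw_mul_le_one hf1)
  · refine h.trans ?_
    rw [Fintype.card_fin]
    gcongr with t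
    refine Finset.sum_le_sum fun y _ =>
      mul_le_mul_of_nonneg_right ?_ (c.sum_stopLaw_mul_nonneg hf0 y)
    rw [← c.prod_mul_likelihood hac]
    exact mul_le_mul_of_nonneg_left (c.truncLikelihood_le_likelihood Q star a m t y) (hw y)
  · refine le_trans (le_of_eq ?_) (Finset.sum_le_sum fun t _ =>
      c.one_sub_le_sum_mul_truncLikelihood hac hs hmgf a m t)
    rw [Finset.sum_const, Finset.card_univ, nsmul_eq_mul, mul_comm]
  · rw [Fintype.card_fin]
    exact c.second_moment_truncLikelihood_le hac hA a m

end Code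

variable [Fintype Y]

/-- At every rate the achievable exponents are at most the synchronization threshold. -/
theorem le_syncThreshold_of_achievable [Finite X] (Q : X → PMF Y) (star : X) {R α : ℝ≥0}
    (h : Achievable Q star R α) : (α : ℝ≥0∞) ≤ syncThreshold Q star := by
  by_contra! hlt
  have hdiv : ∀ x, divergence (Q x) (Q star) ≤ syncThreshold Q star :=
    fun x => le_iSup (fun x => divergence (Q x) (Q star)) x
  have htop : syncThreshold Q star ≠ ∞ := (hlt.trans ENNReal.coe_lt_top).ne
  have hac : ∀ x b, Q star b = 0 → Q x b = 0 := fun x =>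
    absolutelyContinuous_of_divergence_ne_top _ _ (ne_top_of_le_ne_top htop (hdiv x))
  set β : ℝ := (syncThreshold Q star).toReal
  have hβα : β < α := by
    have := (ENNReal.toReal_lt_toReal htop ENNReal.coe_ne_top).2 hlt
    rwa [ENNReal.coe_toReal] at this
  obtain ⟨γ, hγ⟩ : ∃ γ : ℝ, γ = α - β := ⟨_, rfl⟩
  have hγ0 : 0 < γ := by linarith
  obtain ⟨s, hs, hs0⟩ : ∃ s : ℝ, (∀ x, ∑ b, (Q x b).toReal *
      Real.exp (s * Real.log ((Q x b).toReal / (Q star b).toReal))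
        ≤ Real.exp (s * (β + γ / 4))) ∧ 0 < s := by
    refine ((eventually_all.2 fun x => eventually_sum_mul_exp_log_le (Q x) (Q star) (hac x)
      ?_).and self_mem_nhdsWithin).exists
    have := ENNReal.toReal_mono htop (hdiv x)
    linarith
  set ε : ℝ := min (1 / 8) (γ / 4)
  have hε : 0 < ε := by positivity
  have hε1 : ε ≤ 1 / 8 := min_le_left _ _
  have hε2 : ε ≤ γ / 4 := min_le_right _ _
  obtain ⟨n, hc, hn1, hn2⟩ := ((h ε hε).and
    ((eventually_exp_neg_le (by positivity : 0 < s * (γ / 4))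
      (by norm_num : (0 : ℝ) < 1 / 64)).and
    (eventually_mul_exp_neg_le 2 (by positivity : 0 < γ / 4)
      (by norm_num : (0 : ℝ) < 1 / 32)))).exists
  obtain ⟨A, hAdef⟩ : ∃ A, A = ⌈Real.exp (((α : ℝ) - ε) * n)⌉₊ := ⟨_, rfl⟩
  rw [← hAdef] at hc
  obtain ⟨c, -, herr⟩ := hc
  have hn0 : (0 : ℝ) ≤ n := Nat.cast_nonneg n
  have hAexp : Real.exp (((α : ℝ) - ε) * n) ≤ A := hAdef ▸ Nat.le_ceil _
  have hA0 : (0 : ℝ) < A := (Real.exp_pos _).trans_le hAexp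
  have hA : 0 < A := by exact_mod_cast hA0
  have herr' := (c.errorProb_le_iff Q star hA hε.le).1 herr
  have hM := c.two_le_M
  -- The truncation level n(β + γ/2) lies above the likely log-likelihood ratios, so little mass is
  -- lost, and γn/4 below the lower bound for ln A, so overlapping pairs are negligible.
  have hη : Real.exp (s * (n * (β + γ / 4) - n * (β + γ / 2))) ≤ 1 / 64 :=
    le_trans (le_of_eq (by congr 1; ring)) hn1
  have hκ : 2 * n * Real.exp (n * (β + γ / 2)) / A ≤ 1 / 32 := by
    refine le_trans ?_ hn2
    rw [div_le_iff₀ hA0, mul_assoc (2 * (n : ℝ))]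
    refine mul_le_mul_of_nonneg_left ?_ (by positivity)
    refine le_trans ?_ (mul_le_mul_of_nonneg_left hAexp (Real.exp_pos _).le)
    rw [← Real.exp_add]
    refine Real.exp_le_exp.2 ?_
    have h1 := mul_le_mul_of_nonneg_right hε2 hn0
    have h2 : (α : ℝ) = β + γ := by linarith
    rw [h2]
    nlinarith
  -- The three contributions are 1/8 each: the error, l, and (2/64 + 1/32)/(4l) with l = 1/8.
  have hbound : ∀ m : Fin c.M, c.inputExpect Q (fun _ => star)
      (fun s y => if c.decision s y = m then 0 else 1) ≤ 3 / 8 := by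
    intro m
    have h1 := c.inputExpect_star_le hac hA hs0.le hs (n * (β + γ / 2))
      (by norm_num : (0 : ℝ) < 1 / 8) m
      (f := fun s y => if c.decision s y = m then 0 else 1)
      (fun _ _ => by split_ifs <;> norm_num) (fun _ _ => by split_ifs <;> norm_num)
    have h2 := (div_le_iff₀ hA0).2 (herr' m)
    rw [show (4 * (1 / 8) : ℝ) = 1 / 2 by norm_num] at h1
    linarith
  -- Under noise every decision differs from one of the first two messages.
  have hone : (1 : ℝ) ≤ 3 / 8 + 3 / 8 := by
    refine le_trans ?_ (add_le_add (hbound ⟨0, by omega⟩) (hbound ⟨1, by omega⟩))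
    rw [← Code.inputExpect_add]
    refine (c.inputExpect_one Q fun _ => star).ge.trans ?_
    refine c.inputExpect_mono Q _ fun s y => ?_
    by_cases h0 : c.decision s y = ⟨0, by omega⟩
    · simp [h0]
    · rw [if_neg h0]
      split_ifs <;> norm_num
  norm_num at hone

/-! ### Capacity bounds and discontinuity at zero. -/

theorem asyncCapacity_le_maxReverseDivergence [Fintype X] (Q : X → PMF Y) (star : X) {R : ℝ≥0}
    (hR : 0 < R) : asyncCapacity Q star R ≤ maxReverseDivergence Q star :=
  iSup₂_le fun _ h => le_maxReverseDivergence_of_achievable Q star hR h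

theorem asyncCapacity_zero [Finite X] (Q : X → PMF Y) (star : X) :
    asyncCapacity Q star 0 = syncThreshold Q star := by
  refine le_antisymm (iSup₂_le fun _ h => le_syncThreshold_of_achievable Q star h) ?_
  refine ENNReal.le_of_forall_nnreal_lt fun α hα => ?_
  exact le_iSup₂ (f := fun (α : ℝ≥0) (_ : Achievable Q star 0 α) => (α : ℝ≥0∞)) α
    (achievable_zero_of_lt_syncThreshold Q star hα)

end

end AsyncChannel

end

theorem corollary3 {X Y : Type*} [Fintype X] [Fintype Y] (Q : X → PMF Y) (star : X)
    (h : AsyncChannel.maxReverseDivergence Q star < AsyncChannel.syncThreshold Q star) :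
    ¬ ContinuousAt (AsyncChannel.asyncCapacity Q star) 0 ∧
    (∀ R : ℝ≥0, 0 < R →
      AsyncChannel.asyncCapacity Q star R ≤ AsyncChannel.maxReverseDivergence Q star) ∧
    AsyncChannel.maxReverseDivergence Q star < AsyncChannel.asyncCapacity Q star 0 ∧
    AsyncChannel.asyncCapacity Q star 0 = AsyncChannel.syncThreshold Q star := by
  have h0 := AsyncChannel.asyncCapacity_zero Q star
  have hpos : ∀ R : ℝ≥0, 0 < R →
      AsyncChannel.asyncCapacity Q star R ≤ AsyncChannel.maxReverseDivergence Q star :=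
    fun R hR => AsyncChannel.asyncCapacity_le_maxReverseDivergence Q star hR
  refine ⟨fun hcont => ?_, hpos, h0 ▸ h, h0⟩
  -- Continuity would carry the bound for R > 0 to the limit along R tending to 0 from the right.
  have hle : AsyncChannel.asyncCapacity Q star 0 ≤ AsyncChannel.maxReverseDivergence Q star :=
    le_of_tendsto (hcont.tendsto.mono_left (nhdsWithin_le_nhds (s := Set.Ioi 0)))
      (by filter_upwards [self_mem_nhdsWithin] with R hR using hpos R hR)
  exact absurd h (not_lt.2 (h0 ▸ hle))
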